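/- A full tuple-generating dependency (full tgd) is a sentence $\forall\bar x\,\forall\bar y\,\bigl(\varphi(\bar x,\bar y)\to\psi(\bar x)\bigr)$, where $\varphi$ and $\psi$ are nonempty conjunctions of relational atoms over variables and constants and every variable of $\psi$ occurs in $\varphi$ (a Datalog rule). A conjunctive query (CQ) is a formula $q(\bar x)=\exists\bar y\,\bigl(R_1(\bar v_1)\wedge\dots\wedge R_m(\bar v_m)\bigr)$ with $m\ge 1$ over variables and constants. It is acyclic if it has a join tree: a tree whose nodes are labelled by the atoms of $q$, each atom labelling at least one node, such that for every variable the nodes whose labels mention it form a connected subset. For a finite set $\Sigma$ of full tgds over a schema $\sigma$ and CQs $q,q'$ over $\sigma$, write $q\subseteq_\Sigma q'$ if $q(I)\subseteq q'(I)$ for every (finite or infinite) instance $I$ over $\sigma$ that satisfies $\Sigma$, and $q\equiv_\Sigma q'$ if $q\subseteq_\Sigma q'$ and $q'\subseteq_\Sigma q$. Then the following hold. (1) The containment problem for full tgds is decidable: there is an algorithm that, given a finite schema $\sigma$, CQs $q,q'$ over $\sigma$ and a finite set $\Sigma$ of full tgds over $\sigma$, decides whether $q\subseteq_\Sigma q'$.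 (2) Semantic acyclicity under full tgds is undecidable: there is no algorithm that, given a finite schema $\sigma$, a CQ $q$ over $\sigma$ and a finite set $\Sigma$ of full tgds over $\sigma$, decides whether there is an acyclic CQ $q'$ over $\sigma$ with $q\equiv_\Sigma q'$. -/

import Mathlib

/-! Conjunctive queries, tuple-generating dependencies, join trees, and decision problems. -/

namespace SemAc

/-- Constants, labelled nulls and variables: three countably infinite sets. Their disjointness is
provided by the sum types `Term` and `Value` below. -/
abbrev Const := ℕ

/-- Labelled nulls. -/
abbrev Null := ℕ

/-- Variables. -/
abbrev Var := ℕ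

/-- A term of a query or of a dependency: a constant `Sum.inl c` or a variable `Sum.inr x`. -/
abbrev Term := Const ⊕ Var

/-- An element of an instance: a constant `Sum.inl c` or a null `Sum.inr n`. -/
abbrev Value := Const ⊕ Null

/-- A (finite) relational schema, given by the list of the arities of its relation symbols; the
relation symbols are the positions in the list. -/
abbrev Schema := List ℕ

/-- An atom `R(v₁, …, vₙ)` without nulls. -/
abbrev Atom := ℕ × List Term

/-- An atom over constants and nulls. -/
abbrev Fact := ℕ × List Value

/-- `r` is a relation symbol of the schema, of positive arity `n`. -/
def Schema.HasRel (σ : Schema) (r n : ℕ) : Prop := σ[r]? = some n ∧ 0 < n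

/-- The atom is over the schema. -/
def Atom.IsOver (A : Atom) (σ : Schema) : Prop := σ.HasRel A.1 A.2.length

/-- The variable `x` occurs in some atom of the conjunction `φ`. -/
def Occurs (x : Var) (φ : List Atom) : Prop := ∃ A ∈ φ, (Sum.inr x : Term) ∈ A.2

/-- A conjunction of at least one atom, over the schema. -/
def IsConjunction (σ : Schema) (φ : List Atom) : Prop := φ ≠ [] ∧ ∀ A ∈ φ, A.IsOver σ

/-- A possibly infinite set of facts. -/
abbrev Instance := Set Fact

/-- The instance is over the schema. -/
def Instance.IsOver (I : Instance) (σ : Schema) : Prop := ∀ F ∈ I, σ.HasRel F.1 F.2.length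

/-- The extension of a map on variables to terms, the identity on constants. -/
def applyTerm (h : Var → Value) : Term → Value
  | Sum.inl c => Sum.inl c
  | Sum.inr x => h x

/-- The image `R(h(v₁), …, h(vₙ))` of an atom. -/
def Atom.apply (h : Var → Value) (A : Atom) : Fact := (A.1, A.2.map (applyTerm h))

/-- `h` (extended by the identity on constants) is a homomorphism from the conjunction `φ` to the
instance `I`. -/
def IsHom (h : Var → Value) (φ : List Atom) (I : Instance) : Prop := ∀ A ∈ φ, A.apply h ∈ I

/-- A conjunctive query `q(x̄) := ∃ ȳ (R₁(v̄₁) ∧ … ∧ Rₘ(v̄ₘ))`: the tuple `x̄` of free variables and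
the list of atoms; all other variables are existentially quantified. -/
abbrev CQ := List Var × List Atom

/-- The tuple of free variables. -/
abbrev CQ.free (q : CQ) : List Var := q.1

/-- The atoms of the query. -/
abbrev CQ.atoms (q : CQ) : List Atom := q.2

/-- The query is a well-formed conjunctive query over the schema: it has at least one atom, its
atoms are over the schema, and its answer tuple lists distinct variables occurring in it. -/
def CQ.IsOver (q : CQ) (σ : Schema) : Prop :=
  IsConjunction σ q.atoms ∧ q.free.Nodup ∧ ∀ x ∈ q.free, Occurs x q.atoms

/-- The evaluation `q(I)`. -/
def CQ.eval (q : CQ) (I : Instance) : Set (List Value) :=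
  {t | ∃ h : Var → Value, IsHom h q.atoms I ∧ t = q.free.map h}

/-- A join tree of an instance: a tree whose nodes are labelled by atoms of the instance, such that
every atom is a label and, for each null, the nodes whose label mentions it are connected. -/
def Instance.IsAcyclic (I : Instance) : Prop :=
  ∃ (N : Type) (T : SimpleGraph N) (label : N → Fact),
    T.IsTree ∧ (∀ t, label t ∈ I) ∧ (∀ F ∈ I, ∃ t, label t = F) ∧
      ∀ x : Null, (T.induce {t | (Sum.inr x : Value) ∈ (label t).2}).Preconnected

/-- The instance consisting of the atoms of the query, each variable being replaced by a null of
its own. -/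
def CQ.canonicalInstance (q : CQ) : Instance := {F | ∃ A ∈ q.atoms, F = A.apply Sum.inr}

/-- The query is acyclic. -/
def CQ.IsAcyclic (q : CQ) : Prop := q.canonicalInstance.IsAcyclic

/-- A tuple-generating dependency `φ(x̄, ȳ) → ∃ z̄ ψ(x̄, z̄)`: its body `φ` and its head `ψ`. The
variables `x̄` are those common to body and head; `z̄` are those that occur only in the head. -/
abbrev TGD := List Atom × List Atom

/-- The body of a tgd. -/
abbrev TGD.body (τ : TGD) : List Atom := τ.1

/-- The head of a tgd. -/
abbrev TGD.head (τ : TGD) : List Atom := τ.2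

/-- The tgd is well-formed over the schema. -/
def TGD.IsOver (τ : TGD) (σ : Schema) : Prop := IsConjunction σ τ.body ∧ IsConjunction σ τ.head

/-- The tgd is full: it has no existentially quantified variables. -/
def TGD.IsFull (τ : TGD) : Prop := ∀ x, Occurs x τ.head → Occurs x τ.body

/-- The instance satisfies the tgd. -/
def TGD.Holds (τ : TGD) (I : Instance) : Prop :=
  ∀ h : Var → Value, IsHom h τ.body I →
    ∃ h' : Var → Value, (∀ x, Occurs x τ.body → Occurs x τ.head → h' x = h x) ∧ IsHom h' τ.head I

/-- The instance satisfies a finite set of tgds (given as a list). -/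
def Models (I : Instance) (D : List TGD) : Prop := ∀ τ ∈ D, τ.Holds I

/-- Containment `q ⊆ q'` over all (finite or infinite) instances over `σ` that satisfy `D`. -/
def Contained (σ : Schema) (D : List TGD) (q q' : CQ) : Prop :=
  ∀ I : Instance, I.IsOver σ → Models I D → q.eval I ⊆ q'.eval I

/-- Equivalence of queries under `D`. -/
def Equivalent (σ : Schema) (D : List TGD) (q q' : CQ) : Prop :=
  Contained σ D q q' ∧ Contained σ D q' q

/-- The query is semantically acyclic under `D`. -/
def SemanticallyAcyclic (σ : Schema) (D : List TGD) (q : CQ) : Prop :=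
  ∃ q' : CQ, q'.IsOver σ ∧ q'.IsAcyclic ∧ Equivalent σ D q q'

/-- The class of finite sets of full tgds. -/
def FullTGDs : Set (List TGD) := {D | ∀ τ ∈ D, τ.IsFull}

/-- A decision problem: the admissible inputs among the elements of a type of codes, and the
question asked about them. -/
structure DecisionProblem (α : Type) where
  /-- The admissible inputs. -/
  IsInput : α → Prop
  /-- The question. -/
  Question : α → Prop

/-- Some algorithm answers the question correctly on every admissible input. -/
def DecisionProblem.IsDecidable {α : Type} [Primcodable α] (P : DecisionProblem α) : Prop :=
  ∃ f : α → Bool, Computable f ∧ ∀ a, P.IsInput a → (f a = true ↔ P.Question a)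

/-- Semantic acyclicity for a class `C` of sets of tgds. The input `(σ, q, D)` is a schema, a
conjunctive query over it, and a finite set of tgds over it that belongs to `C`. -/
def SemAcProblem (C : Set (List TGD)) : DecisionProblem (Schema × CQ × List TGD) where
  IsInput := fun (σ, q, D) => q.IsOver σ ∧ (∀ τ ∈ D, τ.IsOver σ) ∧ D ∈ C
  Question := fun (σ, q, D) => SemanticallyAcyclic σ D q

/-- Containment of conjunctive queries for a class `C` of sets of tgds. The input `(σ, q, q', D)`
is a schema, two conjunctive queries over it, and a finite set of tgds over it that belongs
to `C`. -/
def ContProblem (C : Set (List TGD)) : DecisionProblem (Schema × CQ × CQ × List TGD) where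
  IsInput := fun (σ, q, q', D) =>
    q.IsOver σ ∧ q'.IsOver σ ∧ (∀ τ ∈ D, τ.IsOver σ) ∧ D ∈ C
  Question := fun (σ, q, q', D) => Contained σ D q q'

end SemAc

/-! ### Decidability of containment under full tgds -/

namespace SemAc

/-! ### Bounded quantification over computed lists -/

section Primrec

variable {α β : Type} [Primcodable α] [Primcodable β]

/-! Containment. Full tgds create no new values, so everything derivable from the canonical facts of
`q` lies in a finite base computed from the input. Instead of running the chase, the procedure tests
every sublist of the base that contains the canonical facts and is closed under the tgds: `q'` must
match in each, with the answer tuple of `q`. A closed sublist is itself an instance satisfying the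
tgds, so the test is necessary. It is sufficient because a match of `q` in any model pulls the model
back to a closed sublist (`contained_of_contCheck`, `contCheck_of_contained`). All quantifiers are
bounded, so the test is primitive recursive.

Semantic acyclicity. The halting problem is reduced to the existence of a two-head run in which both
heads read the same word, and this to semantic acyclicity of a cyclic query. In that query every
letter gives a directed 4-cycle with labels 1, 2, letter, 0, and all these cycles share the edges 1
and 2. Relations 3, 4, 5 are synchronization facts: they pair the positions of the first and the
second head in one of three states. The tgds start both heads at one place, move them by the rules,
and, when they meet in state 2, close the path into a copy of the cyclic query.

A run that reads `U` with both heads yields an acyclic equivalent, namely a path spelling `U` and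
then all letters. The path maps to the cycle by unrolling, and on the path the tgds simulate the run
and rebuild the cycle (`semanticallyAcyclic_of_run`).

Conversely, an acyclic equivalent `q` maps to a model of the tgds over the cycle. This colours its
variables by positions modulo 4 and makes its atoms binary without constants, so its Gaifman graph
is a forest (`gaifman_isAcyclic`). Colours advance by one along path edges, hence labelled walks
never backtrack; they are paths of the forest, and their endpoints determine their labels
(`labelWalk_unique`). Heads that meet have therefore read the same word. Synchronization atoms
already present in `q` do no harm: each is a bridge whose ends the path edges do not connect
(`not_reachable_of_sync`). If no run exists, closing never happens, and `q` with its derived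
synchronization facts is a model into which the cycle cannot map (`run_of_semanticallyAcyclic`).

Halting. The stretch of word between the heads is a queue that holds a Turing configuration up to
rotation. The first head consumes it while the second writes the successor; after halting the first
head catches up (`exists_run_iff_halts`). For a fixed machine only the start rule depends on the
input. -/

theorem primrecPred_forall_mem {f : α → List β} {p : α → β → Prop} (hf : Primrec f)
    (hp : PrimrecRel p) : PrimrecPred fun a => ∀ b ∈ f a, p a b := by
  have h : PrimrecRel fun (b : β) (a : α) => p a b :=
    PrimrecRel.comp hp Primrec.snd Primrec.fst
  exact (PrimrecRel.forall_mem_list h).comp hf Primrec.id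

theorem primrecPred_exists_mem {f : α → List β} {p : α → β → Prop} (hf : Primrec f)
    (hp : PrimrecRel p) : PrimrecPred fun a => ∃ b ∈ f a, p a b := by
  have h : PrimrecRel fun (b : β) (a : α) => p a b :=
    PrimrecRel.comp hp Primrec.snd Primrec.fst
  exact (PrimrecRel.exists_mem_list h).comp hf Primrec.id

theorem primrecPred_mem {f : α → β} {g : α → List β} (hf : Primrec f) (hg : Primrec g) :
    PrimrecPred fun a => f a ∈ g a := by
  have h : PrimrecPred fun a => ∃ b ∈ g a, b = f a :=
    primrecPred_exists_mem hg (PrimrecRel.comp Primrec.eq Primrec.snd (hf.comp Primrec.fst))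
  exact h.of_eq fun a => by simp

theorem primrecPred_imp {p q : α → Prop} (hp : PrimrecPred p) (hq : PrimrecPred q) :
    PrimrecPred fun a => p a → q a :=
  (hp.not.or hq).of_eq fun _ => imp_iff_not_or.symm

end Primrec

/-! ### Tuples and sublists -/

/-- All lists of length `n` with entries in `U`. -/
def tuples {α : Type} (U : List α) (n : ℕ) : List (List α) :=
  Nat.rec [[]] (fun _ ls => ls.flatMap fun l => U.map fun a => a :: l) n

theorem mem_tuples {α : Type} {U : List α} {n : ℕ} {l : List α} :
    l ∈ tuples U n ↔ l.length = n ∧ ∀ a ∈ l, a ∈ U := by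
  induction n generalizing l with
  | zero =>
    have : tuples U 0 = [[]] := rfl
    rw [this, List.mem_singleton, List.length_eq_zero_iff]
    constructor
    · rintro rfl; simp
    · exact And.left
  | succ n ih =>
    have : tuples U (n + 1) = (tuples U n).flatMap fun l => U.map fun a => a :: l := rfl
    rw [this]
    simp only [List.mem_flatMap, List.mem_map, ih]
    constructor
    · rintro ⟨l, ⟨h₁, h₂⟩, a, ha, rfl⟩
      simp [h₁, ha]
      exact h₂
    · rintro ⟨h₁, h₂⟩
      cases l with
      | nil => simp at h₁
      | cons a l => exact ⟨l, ⟨by simpa using h₁, fun b hb => h₂ b (by simp [hb])⟩, a, h₂ a (by simp), rfl⟩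

theorem primrec_tuples {α : Type} [Primcodable α] : Primrec₂ (tuples (α := α)) := by
  have hstep : Primrec₂ fun (p : List α × ℕ) (q : ℕ × List (List α)) =>
      q.2.flatMap fun l => p.1.map fun a => a :: l := by
    refine Primrec.list_flatMap (Primrec.snd.comp Primrec.snd) ?_
    refine Primrec.list_map ((Primrec.fst.comp Primrec.fst).comp Primrec.fst) ?_
    exact Primrec.list_cons.comp Primrec.snd (Primrec.snd.comp Primrec.fst)
  exact Primrec.nat_rec' Primrec.snd (Primrec.const [[]]) hstep

/-- All sublists of a list. -/
def subs {α : Type} (l : List α) : List (List α) :=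
  l.foldr (fun a ls => ls ++ ls.map fun s => a :: s) [[]]

/-- The closed sets in the soundness argument arise by filtering the base, so it suffices that
filters are enumerated. -/
theorem filter_mem_subs {α : Type} (p : α → Bool) (l : List α) : l.filter p ∈ subs l := by
  induction l with
  | nil => simp [subs]
  | cons a l ih =>
    have : subs (a :: l) = subs l ++ (subs l).map fun s => a :: s := rfl
    rw [this, List.filter_cons]
    split <;> simp [ih]

theorem subset_of_mem_subs {α : Type} {l s : List α} (h : s ∈ subs l) : s ⊆ l := by
  induction l generalizing s with
  | nil => simp [subs] at h; simp [h]
  | cons a l ih =>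
    have : subs (a :: l) = subs l ++ (subs l).map fun s => a :: s := rfl
    rw [this, List.mem_append, List.mem_map] at h
    rcases h with h | ⟨t, ht, rfl⟩
    · exact fun x hx => List.mem_cons_of_mem _ (ih h hx)
    · intro x hx
      rcases List.mem_cons.1 hx with rfl | hx
      · simp
      · exact List.mem_cons_of_mem _ (ih ht hx)

theorem primrec_subs {α : Type} [Primcodable α] : Primrec (subs (α := α)) := by
  have h : Primrec₂ fun (_ : List α) (p : α × List (List α)) =>
      p.2 ++ p.2.map fun s => p.1 :: s :=
    Primrec.list_append.comp (Primrec.snd.comp Primrec.snd)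
      (Primrec.list_map (Primrec.snd.comp Primrec.snd)
        (Primrec.list_cons.comp ((Primrec.fst.comp Primrec.snd).comp Primrec.fst) Primrec.snd))
  exact Primrec.list_foldr Primrec.id (Primrec.const [[]]) h

/-! ### Assignments given by lists of values -/

/-- The index of the first occurrence of a term in a list. -/
def termIdx {α : Type} [DecidableEq α] (ts : List α) (t : α) : ℕ := ts.idxOf t

theorem primrec_termIdx {α : Type} [Primcodable α] [DecidableEq α] : Primrec₂ (termIdx (α := α)) :=
  Primrec.list_idxOf.comp Primrec.snd Primrec.fst

theorem termIdx_lt {α : Type} [DecidableEq α] {ts : List α} {t : α} (ht : t ∈ ts) :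
    termIdx ts t < ts.length := List.idxOf_lt_length_iff.2 ht

theorem getElem_termIdx {α : Type} [DecidableEq α] {ts : List α} {t : α}
    (ht : termIdx ts t < ts.length) : ts[termIdx ts t] = t := List.getElem_idxOf ht

/-- The assignment that sends the `i`-th term of `ts`, if it is a variable, to the `i`-th entry
of `l`. -/
def assign (ts : List Term) (l : List Value) (x : Var) : Value :=
  l.getD (termIdx ts (Sum.inr x)) (Sum.inl 0)

theorem assign_map {ts : List Term} {x : Var} (k : Term → Value) (hx : Sum.inr x ∈ ts) :
    assign ts (ts.map k) x = k (Sum.inr x) := by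
  have h := termIdx_lt hx
  have e := getElem_termIdx h
  simp [assign, List.getD_eq_getElem?_getD, h, e]

/-- The value `Sum.inl 0` is the default returned when the index is out of range, hence the
condition `h0`. -/
theorem assign_mem {ts U : List Value} {l : List Value} (hl : ∀ a ∈ l, a ∈ U)
    (h0 : Sum.inl 0 ∈ U) (x : Var) : assign ts l x ∈ U := by
  unfold assign
  rw [List.getD_eq_getElem?_getD]
  cases h : l[termIdx ts (Sum.inr x)]? with
  | none => simpa using h0
  | some v => simpa using hl v (List.mem_of_getElem? h)

theorem Atom.apply_congr {h k : Var → Value} {A : Atom}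
    (H : ∀ x, (Sum.inr x : Term) ∈ A.2 → h x = k x) : A.apply h = A.apply k := by
  unfold Atom.apply
  congr 1
  apply List.map_congr_left
  rintro (c | x) ht
  · rfl
  · exact H x ht

theorem primrec_assign :
    Primrec fun p : (List Term × List Value) × Var => assign p.1.1 p.1.2 p.2 :=
  (Primrec.list_getD (Sum.inl 0 : Value)).comp (Primrec.snd.comp Primrec.fst)
    (primrec_termIdx.comp (Primrec.fst.comp Primrec.fst) (Primrec.sumInr.comp Primrec.snd))

theorem primrec_applyTerm_assign :
    Primrec fun p : (List Term × List Value) × Term => applyTerm (assign p.1.1 p.1.2) p.2 := by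
  have : Primrec fun q : (List Term × List Value) × Term =>
      (Sum.casesOn q.2 (fun c => Sum.inl c) (fun x => assign q.1.1 q.1.2 x) : Value) :=
    Primrec.sumCasesOn Primrec.snd (Primrec.sumInl.comp Primrec.snd)
      (primrec_assign.comp (Primrec.pair (Primrec.fst.comp Primrec.fst) Primrec.snd))
  exact this.of_eq fun q => by rcases q with ⟨_, c | x⟩ <;> rfl

theorem primrec_apply_assign :
    Primrec fun p : (List Term × List Value) × Atom => Atom.apply (assign p.1.1 p.1.2) p.2 :=
  Primrec.pair (Primrec.fst.comp Primrec.snd)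
    (Primrec.list_map (Primrec.snd.comp Primrec.snd)
      (primrec_applyTerm_assign.comp (Primrec.pair (Primrec.fst.comp Primrec.fst) Primrec.snd)))

/-! ### The decision procedure for containment under full tgds -/

/-- An input of the containment problem. -/
abbrev ContInput := Schema × CQ × CQ × List TGD

/-- The terms of an input, together with a dummy constant. As terms and values have the same
underlying type, this is also a list of values: every variable stands for a null of its own. -/
def contTerms (a : ContInput) : List Term :=
  Sum.inl 0 :: (a.2.1.2 ++ a.2.2.1.2 ++ a.2.2.2.flatMap fun τ => τ.1 ++ τ.2).flatMap Prod.snd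

/-- The lists of values that represent the assignments. -/
def contAssignments (a : ContInput) : List (List Value) :=
  tuples (contTerms a) (contTerms a).length

/-- The canonical facts of the first query. -/
def contCanonical (a : ContInput) : List Fact := a.2.1.2

/-- A finite base of facts that contains the chase of the first query. -/
def contBase (a : ContInput) : List Fact :=
  contCanonical a ++ a.2.2.2.flatMap fun τ => (contAssignments a).flatMap fun l =>
    τ.2.map (Atom.apply (assign (contTerms a) l))

theorem primrec_contTerms : Primrec contTerms := by
  refine Primrec.list_cons.comp (Primrec.const _) ?_
  refine Primrec.list_flatMap ?_ (Primrec.snd.comp Primrec.snd)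
  refine Primrec.list_append.comp (Primrec.list_append.comp ?_ ?_) ?_
  · exact Primrec.snd.comp (Primrec.fst.comp Primrec.snd)
  · exact Primrec.snd.comp (Primrec.fst.comp (Primrec.snd.comp Primrec.snd))
  · refine Primrec.list_flatMap (Primrec.snd.comp (Primrec.snd.comp Primrec.snd)) ?_
    exact Primrec.list_append.comp (Primrec.fst.comp Primrec.snd) (Primrec.snd.comp Primrec.snd)

theorem primrec_contAssignments : Primrec contAssignments :=
  primrec_tuples.comp primrec_contTerms (Primrec.list_length.comp primrec_contTerms)

theorem primrec_contCanonical : Primrec contCanonical :=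
  Primrec.snd.comp (Primrec.fst.comp Primrec.snd)

theorem primrec_contBase : Primrec contBase := by
  refine Primrec.list_append.comp primrec_contCanonical ?_
  refine Primrec.list_flatMap (Primrec.snd.comp (Primrec.snd.comp Primrec.snd)) ?_
  refine Primrec.list_flatMap (primrec_contAssignments.comp Primrec.fst) ?_
  refine Primrec.list_map (Primrec.snd.comp (Primrec.snd.comp Primrec.fst)) ?_
  refine primrec_apply_assign.comp (Primrec.pair (Primrec.pair ?_ ?_) Primrec.snd)
  · exact primrec_contTerms.comp (Primrec.fst.comp (Primrec.fst.comp Primrec.fst))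
  · exact Primrec.snd.comp Primrec.fst

/-- The assignment `l` maps every atom of `φ` into `I`. -/
def AssignHom (a : ContInput) (l : List Value) (φ : List Atom) (I : List Fact) : Prop :=
  ∀ A ∈ φ, Atom.apply (assign (contTerms a) l) A ∈ I

/-- The condition checked by the decision procedure. -/
def ContCheck (a : ContInput) : Prop :=
  ∀ I ∈ subs (contBase a), (∀ F ∈ contCanonical a, F ∈ I) →
    (∀ τ ∈ a.2.2.2, ∀ l ∈ contAssignments a, AssignHom a l τ.1 I → AssignHom a l τ.2 I) →
    ∃ l ∈ contAssignments a, AssignHom a l a.2.2.1.2 I ∧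
      a.2.2.1.1.map (assign (contTerms a) l) = a.2.1.1.map Sum.inr

theorem primrecPred_assignHom {α : Type} [Primcodable α] {f : α → ContInput} {l : α → List Value}
    {φ : α → List Atom} {I : α → List Fact} (hf : Primrec f) (hl : Primrec l) (hφ : Primrec φ)
    (hI : Primrec I) : PrimrecPred fun x => AssignHom (f x) (l x) (φ x) (I x) := by
  refine primrecPred_forall_mem hφ ?_
  refine primrecPred_mem ?_ (hI.comp Primrec.fst)
  exact primrec_apply_assign.comp (Primrec.pair (Primrec.pair
    ((primrec_contTerms.comp hf).comp Primrec.fst) (hl.comp Primrec.fst)) Primrec.snd)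

theorem primrecPred_contCheck : PrimrecPred ContCheck := by
  have h₁ : PrimrecPred fun p : ContInput × List Fact => ∀ F ∈ contCanonical p.1, F ∈ p.2 :=
    primrecPred_forall_mem (primrec_contCanonical.comp Primrec.fst)
      (primrecPred_mem Primrec.snd (Primrec.snd.comp Primrec.fst))
  have hD : Primrec fun p : ContInput × List Fact => p.1.2.2.2 :=
    Primrec.snd.comp (Primrec.snd.comp (Primrec.snd.comp Primrec.fst))
  have h₂ : PrimrecPred fun p : ((ContInput × List Fact) × TGD) × List Value =>
      AssignHom p.1.1.1 p.2 p.1.2.1 p.1.1.2 → AssignHom p.1.1.1 p.2 p.1.2.2 p.1.1.2 :=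
    primrecPred_imp
      (primrecPred_assignHom (Primrec.fst.comp (Primrec.fst.comp Primrec.fst)) Primrec.snd
        (Primrec.fst.comp (Primrec.snd.comp Primrec.fst))
        (Primrec.snd.comp (Primrec.fst.comp Primrec.fst)))
      (primrecPred_assignHom (Primrec.fst.comp (Primrec.fst.comp Primrec.fst)) Primrec.snd
        (Primrec.snd.comp (Primrec.snd.comp Primrec.fst))
        (Primrec.snd.comp (Primrec.fst.comp Primrec.fst)))
  have h₃ : PrimrecPred fun p : (ContInput × List Fact) × TGD =>
      ∀ l ∈ contAssignments p.1.1, AssignHom p.1.1 l p.2.1 p.1.2 → AssignHom p.1.1 l p.2.2 p.1.2 :=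
    primrecPred_forall_mem (primrec_contAssignments.comp (Primrec.fst.comp Primrec.fst)) h₂
  have h₄ : PrimrecPred fun p : ContInput × List Fact => ∀ τ ∈ p.1.2.2.2,
      ∀ l ∈ contAssignments p.1, AssignHom p.1 l τ.1 p.2 → AssignHom p.1 l τ.2 p.2 :=
    primrecPred_forall_mem hD h₃
  have hf : Primrec fun p : (ContInput × List Fact) × List Value =>
      p.1.1.2.2.1.1.map (assign (contTerms p.1.1) p.2) :=
    Primrec.list_map
      (Primrec.fst.comp (Primrec.fst.comp
        (Primrec.snd.comp (Primrec.snd.comp (Primrec.fst.comp Primrec.fst)))))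
      (primrec_assign.comp (Primrec.pair (Primrec.pair
        (primrec_contTerms.comp (Primrec.fst.comp (Primrec.fst.comp Primrec.fst)))
        (Primrec.snd.comp Primrec.fst)) Primrec.snd))
  have hf' : Primrec fun p : (ContInput × List Fact) × List Value =>
      p.1.1.2.1.1.map (Sum.inr : Var → Value) :=
    Primrec.list_map
      (Primrec.fst.comp (Primrec.fst.comp (Primrec.snd.comp (Primrec.fst.comp Primrec.fst))))
      (Primrec.sumInr.comp Primrec.snd)
  have h₅ : PrimrecPred fun p : (ContInput × List Fact) × List Value =>
      AssignHom p.1.1 p.2 p.1.1.2.2.1.2 p.1.2 :=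
    primrecPred_assignHom (Primrec.fst.comp Primrec.fst) Primrec.snd
      (Primrec.snd.comp (Primrec.fst.comp
        (Primrec.snd.comp (Primrec.snd.comp (Primrec.fst.comp Primrec.fst)))))
      (Primrec.snd.comp Primrec.fst)
  have h₆ : PrimrecPred fun p : ContInput × List Fact => ∃ l ∈ contAssignments p.1,
      AssignHom p.1 l p.1.2.2.1.2 p.2 ∧
        p.1.2.2.1.1.map (assign (contTerms p.1) l) = p.1.2.1.1.map Sum.inr :=
    primrecPred_exists_mem (primrec_contAssignments.comp Primrec.fst) (h₅.and (PrimrecRel.comp Primrec.eq hf hf'))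
  exact primrecPred_forall_mem (primrec_subs.comp primrec_contBase)
    (primrecPred_imp h₁ (primrecPred_imp h₄ h₆))

/-! ### Correctness -/

theorem applyTerm_applyTerm (h k : Var → Value) (t : Term) :
    applyTerm h (applyTerm k t) = applyTerm (fun x => applyTerm h (k x)) t := by
  rcases t with c | x <;> rfl

/-- The image of a fact under a map on nulls. -/
def Fact.image (h : Null → Value) (F : Fact) : Fact := (F.1, F.2.map (applyTerm h))

theorem Fact.image_apply (h k : Var → Value) (A : Atom) :
    Fact.image h (A.apply k) = A.apply (fun x => applyTerm h (k x)) := by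
  simp only [Fact.image, Atom.apply, List.map_map]
  congr 1
  exact List.map_congr_left fun t _ => applyTerm_applyTerm h k t

/-- Terms and values are literally the same type, so freezing variables as nulls is the identity,
and the atoms of a query already are its canonical facts. -/
theorem Atom.apply_inr (A : Atom) : A.apply Sum.inr = A := by
  obtain ⟨r, l⟩ := A
  simp only [Atom.apply]
  congr 1
  conv_rhs => rw [← List.map_id l]
  apply List.map_congr_left
  rintro (c | x) _ <;> rfl

theorem isHom_canonicalInstance (q : CQ) : IsHom Sum.inr q.atoms q.canonicalInstance :=
  fun A hA => ⟨A, hA, rfl⟩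

theorem atom_apply_isOver {A : Atom} {σ : Schema} (h : A.IsOver σ) (k : Var → Value) :
    σ.HasRel (A.apply k).1 (A.apply k).2.length := by
  have e : (A.apply k).2.length = A.2.length := by simp [Atom.apply]
  rw [e]
  exact h

/-- By fullness, the extension provided by the tgd agrees with `h` on all variables of the head, so
`h` itself works. -/
theorem TGD.Holds.isHom_head {τ : TGD} {I : Instance} (hI : τ.Holds I) (hf : τ.IsFull)
    {h : Var → Value} (hh : IsHom h τ.body I) : IsHom h τ.head I := by
  obtain ⟨h', e, H⟩ := hI h hh
  intro A hA
  have := H A hA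
  rwa [Atom.apply_congr (k := h)] at this
  intro x hx
  exact e x (hf x ⟨A, hA, hx⟩) ⟨A, hA, hx⟩

theorem TGD.holds_of_isHom_head {τ : TGD} {I : Instance}
    (H : ∀ h : Var → Value, IsHom h τ.body I → IsHom h τ.head I) : τ.Holds I :=
  fun h hh => ⟨h, fun _ _ _ => rfl, H h hh⟩

/-- Homomorphisms compose: `k` matches `q'` in `S`, and `h` carries `S` into `I`. -/
theorem CQ.eval_trans {q q' : CQ} {I : Instance} {k h : Var → Value}
    {S : Set Fact} (hk : IsHom k q'.atoms S) (hf : q'.free.map k = q.free.map Sum.inr)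
    (hS : ∀ F ∈ S, Fact.image h F ∈ I) : q.free.map h ∈ q'.eval I := by
  refine ⟨fun x => applyTerm h (k x), fun A hA => ?_, ?_⟩
  · rw [← Fact.image_apply]
    exact hS _ (hk A hA)
  · have := congrArg (List.map (applyTerm h)) hf
    simp only [List.map_map] at this
    exact this.symm

theorem mem_contTerms_of_query {a : ContInput} {A : Atom} {t : Term} (hA : A ∈ a.2.1.2)
    (ht : t ∈ A.2) : t ∈ contTerms a := by
  simp only [contTerms, List.mem_cons, List.mem_flatMap, List.mem_append]
  exact Or.inr ⟨A, Or.inl (Or.inl hA), ht⟩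

theorem mem_contTerms_of_query' {a : ContInput} {A : Atom} {t : Term} (hA : A ∈ a.2.2.1.2)
    (ht : t ∈ A.2) : t ∈ contTerms a := by
  simp only [contTerms, List.mem_cons, List.mem_flatMap, List.mem_append]
  exact Or.inr ⟨A, Or.inl (Or.inr hA), ht⟩

theorem mem_contTerms_of_body {a : ContInput} {τ : TGD} {A : Atom} {t : Term}
    (hτ : τ ∈ a.2.2.2) (hA : A ∈ τ.1) (ht : t ∈ A.2) : t ∈ contTerms a := by
  simp only [contTerms, List.mem_cons, List.mem_flatMap, List.mem_append]
  exact Or.inr ⟨A, Or.inr ⟨τ, hτ, Or.inl hA⟩, ht⟩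

theorem mem_contTerms_of_head {a : ContInput} {τ : TGD} {A : Atom} {t : Term}
    (hτ : τ ∈ a.2.2.2) (hA : A ∈ τ.2) (ht : t ∈ A.2) : t ∈ contTerms a := by
  simp only [contTerms, List.mem_cons, List.mem_flatMap, List.mem_append]
  exact Or.inr ⟨A, Or.inr ⟨τ, hτ, Or.inr hA⟩, ht⟩

/-- Every value of the base is the value of a term of the input. -/
theorem mem_contTerms_of_contBase {a : ContInput} {F : Fact} (hF : F ∈ contBase a) {v : Value}
    (hv : v ∈ F.2) : v ∈ contTerms a := by
  simp only [contBase, List.mem_append, List.mem_flatMap, List.mem_map] at hF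
  rcases hF with hF | ⟨τ, hτ, l, hl, A, hA, rfl⟩
  · exact mem_contTerms_of_query hF hv
  · simp only [Atom.apply, List.mem_map] at hv
    obtain ⟨c | x, ht, rfl⟩ := hv
    · exact mem_contTerms_of_head hτ hA ht
    · exact assign_mem (mem_tuples.1 hl).2 (by simp [contTerms]) x

/-- An assignment that maps the atoms of `φ` to facts of the base is given by a list of values. -/
theorem exists_assignment {a : ContInput} {φ : List Atom} {k : Var → Value}
    (hφ : ∀ A ∈ φ, A.apply k ∈ contBase a) (hts : ∀ A ∈ φ, ∀ t ∈ A.2, t ∈ contTerms a) :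
    ∃ l ∈ contAssignments a, ∀ x, Occurs x φ → assign (contTerms a) l x = k x := by
  classical
  let k' : Term → Value := fun t => if applyTerm k t ∈ contTerms a then applyTerm k t else Sum.inl 0
  refine ⟨(contTerms a).map k', mem_tuples.2 ⟨by simp, ?_⟩, ?_⟩
  · intro v hv
    obtain ⟨t, -, rfl⟩ := List.mem_map.1 hv
    simp only [k']
    split
    · assumption
    · simp [contTerms]
  · rintro x ⟨A, hA, hx⟩
    rw [assign_map _ (hts A hA _ hx)]
    simp only [k']
    rw [if_pos]
    · rfl
    · exact mem_contTerms_of_contBase (hφ A hA) (List.mem_map.2 ⟨_, hx, rfl⟩)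

/-- Given a match `k` of the first query in a model `J`, the test is applied to the base facts whose
image under `k` lies in `J`. This set is closed: the base contains the heads of all represented
assignments, and `J` satisfies the full tgds. The match found there, composed with `k`, is a match
in `J`. -/
theorem contained_of_contCheck {a : ContInput} (hD : a.2.2.2 ∈ FullTGDs) (h : ContCheck a) :
    Contained a.1 a.2.2.2 a.2.1 a.2.2.1 := by
  classical
  rintro J hJ hM _ ⟨k, hk, rfl⟩
  have key := h ((contBase a).filter fun F => Fact.image k F ∈ J) (filter_mem_subs _ _)
  have h₁ : ∀ F ∈ contCanonical a, F ∈ (contBase a).filter fun F => Fact.image k F ∈ J := ?_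
  have h₂ : ∀ τ ∈ a.2.2.2, ∀ l ∈ contAssignments a,
      AssignHom a l τ.1 ((contBase a).filter fun F => Fact.image k F ∈ J) →
        AssignHom a l τ.2 ((contBase a).filter fun F => Fact.image k F ∈ J) := ?_
  · obtain ⟨l, hl, hl₁, hl₂⟩ := key h₁ h₂
    refine CQ.eval_trans (S := {F | F ∈ (contBase a).filter fun F => Fact.image k F ∈ J})
      hl₁ hl₂ fun F hF => ?_
    simpa using (List.mem_filter.1 hF).2
  swap
  · intro F hF
    rw [List.mem_filter]
    refine ⟨by simp [contBase, hF], ?_⟩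
    exact decide_eq_true (hk F hF)
  · intro τ hτ l hl hb A hA
    rw [List.mem_filter]
    constructor
    · simp only [contBase, List.mem_append, List.mem_flatMap, List.mem_map]
      exact Or.inr ⟨τ, hτ, l, hl, A, hA, rfl⟩
    · rw [Fact.image_apply]
      simp only [decide_eq_true_eq]
      refine (hM τ hτ).isHom_head (hD τ hτ) (fun B hB => ?_) A hA
      rw [← Fact.image_apply]
      simpa using (List.mem_filter.1 (hb B hB)).2

/-- A closed sublist is an instance satisfying the tgds, because any assignment sending a body into
the base agrees on the body with one given by a list. Containment is then applied to this instance
and the identity match of the first query. -/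
theorem contCheck_of_contained {a : ContInput} (hq : a.2.1.IsOver a.1) (hq' : a.2.2.1.IsOver a.1)
    (hτ : ∀ τ ∈ a.2.2.2, τ.IsOver a.1) (hD : a.2.2.2 ∈ FullTGDs)
    (h : Contained a.1 a.2.2.2 a.2.1 a.2.2.1) : ContCheck a := by
  intro I hI hc hm
  have hIB := subset_of_mem_subs hI
  have h₁ : Instance.IsOver {F | F ∈ I} a.1 := ?_
  have h₂ : Models {F | F ∈ I} a.2.2.2 := ?_
  · obtain ⟨k, hk, hkf⟩ := h {F | F ∈ I} h₁ h₂ (a := a.2.1.1.map Sum.inr)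
      ⟨Sum.inr, fun A hA => by rw [Atom.apply_inr]; exact hc A hA, rfl⟩
    obtain ⟨l, hl, hlk⟩ := exists_assignment (a := a) (φ := a.2.2.1.2) (k := k)
      (fun A hA => hIB (hk A hA)) fun A hA t ht => mem_contTerms_of_query' hA ht
    refine ⟨l, hl, fun A hA => ?_, ?_⟩
    · rw [Atom.apply_congr (k := k) fun x hx => hlk x ⟨A, hA, hx⟩]
      exact hk A hA
    · rw [hkf]
      exact List.map_congr_left fun x hx => hlk x (hq'.2.2 x hx)
  swap
  · intro F hF
    have hF := hIB hF
    simp only [contBase, List.mem_append, List.mem_flatMap, List.mem_map] at hF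
    rcases hF with hF | ⟨τ, ht, l, hl, A, hA, rfl⟩
    · exact hq.1.2 F hF
    · exact atom_apply_isOver ((hτ τ ht).2.2 A hA) _
  · intro τ ht
    refine TGD.holds_of_isHom_head fun k hk => ?_
    obtain ⟨l, hl, hlk⟩ := exists_assignment (a := a) (φ := τ.1) (k := k)
      (fun A hA => hIB (hk A hA)) fun A hA t => mem_contTerms_of_body ht hA
    have hb : AssignHom a l τ.1 I := fun A hA => by
      rw [Atom.apply_congr (k := k) fun x hx => hlk x ⟨A, hA, hx⟩]
      exact hk A hA
    intro A hA
    -- Fullness again: head variables occur in the body, where `k` and the list assignment agree.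
    rw [← Atom.apply_congr (h := assign (contTerms a) l) fun x hx =>
      hlk x (hD τ ht x ⟨A, hA, hx⟩)]
    exact hm τ ht l hl hb A hA

theorem contProblem_isDecidable : (ContProblem FullTGDs).IsDecidable := by
  obtain ⟨_, hd⟩ := primrecPred_contCheck
  refine ⟨fun a => decide (ContCheck a), hd.to_comp, ?_⟩
  rintro a ⟨hq, hq', hτ, hD⟩
  rw [decide_eq_true_iff]
  exact ⟨contained_of_contCheck hD, contCheck_of_contained hq hq' hτ hD⟩

end SemAc

/-! ### Join trees of binary instances give forests -/

namespace SemAc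

/-! ### The Gaifman graph of an acyclic instance -/

/-- The Gaifman graph of an instance, on its nulls. -/
def gaifman (I : Instance) : SimpleGraph Null where
  Adj a b := a ≠ b ∧ ∃ F ∈ I, (Sum.inr a : Value) ∈ F.2 ∧ (Sum.inr b : Value) ∈ F.2
  symm := ⟨fun _ _ ⟨h, F, hF, ha, hb⟩ => ⟨h.symm, F, hF, hb, ha⟩⟩
  loopless := ⟨fun _ h => h.1 rfl⟩

theorem exists_walk_of_preconnected_induce {V : Type} {T : SimpleGraph V} {S : Set V}
    (h : (T.induce S).Preconnected) {u v : V} (hu : u ∈ S) (hv : v ∈ S) :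
    ∃ p : T.Walk u v, ∀ x ∈ p.support, x ∈ S := by
  obtain ⟨p⟩ := h ⟨u, hu⟩ ⟨v, hv⟩
  refine ⟨p.map (SimpleGraph.Embedding.induce S).toHom, fun x hx => ?_⟩
  replace hx := (SimpleGraph.Walk.support_map _ p) ▸ hx
  rw [List.mem_map] at hx
  obtain ⟨y, -, rfl⟩ := hx
  exact y.2

/-- In a tree, if `n` and `t` are connected within `A`, and `t` and `u` within `B`, then every walk
from `n` to `u` meets `A ∩ B`. -/
theorem exists_mem_support_inter {V : Type} {T : SimpleGraph V} (hT : T.IsAcyclic) {A B : Set V}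
    {n t u : V} (hn : n ∈ A) (hu : u ∈ B) (p : T.Walk n t) (hp : ∀ x ∈ p.support, x ∈ A)
    (q : T.Walk t u) (hq : ∀ x ∈ q.support, x ∈ B) (w : T.Walk n u) :
    ∃ x ∈ w.support, x ∈ A ∧ x ∈ B := by
  classical
  by_contra! hw
  -- A walk that starts in `A`, avoids `A ∩ B`, and has each edge inside `A` or inside `B` can never
  -- leave `A`.
  have key : ∀ {a b : V} (r : T.Walk a b), (∀ x ∈ r.support, x ∈ A → x ∉ B) →
      (∀ x y, s(x, y) ∈ r.edges → (x ∈ A ∧ y ∈ A) ∨ (x ∈ B ∧ y ∈ B)) → a ∈ A → b ∈ A := by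
    intro a b r
    induction r with
    | nil => intro _ _ h; exact h
    | cons hadj r ih =>
      intro h₁ h₂ ha
      refine ih (fun x hx => h₁ x (by simp [hx])) (fun x y hxy => h₂ x y (by simp [hxy])) ?_
      rename_i u v _
      rcases h₂ u v (by simp) with h | h
      · exact h.2
      · exact absurd h.1 (h₁ u (by simp) ha)
  -- Paths in a tree are unique, so the path extracted from `w` uses only edges of `p` and `q`.
  have he : w.bypass = (p.append q).bypass := congrArg Subtype.val
    ((hT.subsingleton_path n u).elim ⟨_, w.bypass_isPath⟩ ⟨_, (p.append q).bypass_isPath⟩)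
  refine hw u w.end_mem_support (key w.bypass
    (fun x hx => hw x (w.support_bypass_subset_support hx)) (fun x y hxy => ?_) hn) hu
  rw [he] at hxy
  have hxy := (p.append q).edges_bypass_subset_edges hxy
  rw [SimpleGraph.Walk.edges_append, List.mem_append] at hxy
  rcases hxy with h | h
  · exact Or.inl ⟨hp _ (p.fst_mem_support_of_mem_edges h), hp _ (p.snd_mem_support_of_mem_edges h)⟩
  · exact Or.inr ⟨hq _ (q.fst_mem_support_of_mem_edges h), hq _ (q.snd_mem_support_of_mem_edges h)⟩

/-- Every edge `{a, b}` is a bridge. A detour from `a` to `b` would lift to a walk in the join tree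
from a node mentioning `a` to a node mentioning `b` that avoids all nodes mentioning both. But the
fact giving the edge labels a node `t` with both nulls, and by `exists_mem_support_inter` every such
walk must meet a node of this kind. -/
theorem gaifman_isAcyclic {I : Instance} (hI : I.IsAcyclic)
    (h2 : ∀ F ∈ I, ∀ a b x : Null, a ≠ b → (Sum.inr a : Value) ∈ F.2 → (Sum.inr b : Value) ∈ F.2 →
      (Sum.inr x : Value) ∈ F.2 → x = a ∨ x = b) : (gaifman I).IsAcyclic := by
  obtain ⟨N, T, label, hT, hlabel, hsurj, hconn⟩ := hI
  let S : Null → Set N := fun x => {t | (Sum.inr x : Value) ∈ (label t).2}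
  rw [SimpleGraph.isAcyclic_iff_forall_adj_isBridge]
  intro a b hab
  rw [SimpleGraph.isBridge_iff]
  rintro ⟨w⟩
  obtain ⟨hne, F, hF, haF, hbF⟩ := hab
  obtain ⟨t, rfl⟩ := hsurj F hF
  -- an edge other than `{a, b}` has a node outside `S a ∩ S b`
  have hedge : ∀ v w : Null, ((gaifman I) \ SimpleGraph.fromEdgeSet {s(a, b)}).Adj v w →
      ∃ n, n ∈ S v ∧ n ∈ S w ∧ ¬ (n ∈ S a ∧ n ∈ S b) := by
    intro v w hvw
    rw [SimpleGraph.sdiff_adj] at hvw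
    obtain ⟨⟨hne', F', hF', hv, hw⟩, hnot⟩ := hvw
    obtain ⟨n, rfl⟩ := hsurj F' hF'
    refine ⟨n, hv, hw, fun ⟨hna, hnb⟩ => hnot ?_⟩
    have h₁ := h2 _ hF' a b v hne hna hnb hv
    have h₂ := h2 _ hF' a b w hne hna hnb hw
    rw [SimpleGraph.fromEdgeSet_adj]
    refine ⟨?_, hne'⟩
    rcases h₁ with rfl | rfl <;> rcases h₂ with rfl | rfl
    · exact absurd rfl hne'
    · rfl
    · exact Sym2.eq_swap
    · exact absurd rfl hne'
  have hwalk : ∀ {v : Null} (p : ((gaifman I) \ SimpleGraph.fromEdgeSet {s(a, b)}).Walk v b),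
      a ∉ p.support → ∀ u ∈ S v, ¬ (u ∈ S a ∧ u ∈ S b) →
      ∃ u' ∈ S b, ∃ q : T.Walk u u', ∀ x ∈ q.support, ¬ (x ∈ S a ∧ x ∈ S b) := by
    intro v p
    -- The endpoint becomes a variable so that induction on the walk applies.
    have : ∀ {v c : Null} (p : ((gaifman I) \ SimpleGraph.fromEdgeSet {s(a, b)}).Walk v c),
        c = b → a ∉ p.support → ∀ u ∈ S v, ¬ (u ∈ S a ∧ u ∈ S b) →
        ∃ u' ∈ S b, ∃ q : T.Walk u u', ∀ x ∈ q.support, ¬ (x ∈ S a ∧ x ∈ S b) := by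
      intro v c p
      induction p with
      | nil =>
        rintro rfl - u hu hn
        exact ⟨u, hu, SimpleGraph.Walk.nil, by simpa using hn⟩
      | @cons v w c hadj p ih =>
        rintro rfl ha u hu hn
        by_cases hvc : v = c
        · subst hvc
          exact ⟨u, hu, SimpleGraph.Walk.nil, by simpa using hn⟩
        · rw [SimpleGraph.Walk.support_cons, List.mem_cons, not_or] at ha
          obtain ⟨n, hnv, hnw, hn'⟩ := hedge _ _ hadj
          obtain ⟨q₁, hq₁⟩ := exists_walk_of_preconnected_induce (hconn v) hu hnv
          obtain ⟨u', hu', q₂, hq₂⟩ := ih rfl ha.2 n hnw hn'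
          refine ⟨u', hu', q₁.append q₂, fun x hx => ?_⟩
          rw [SimpleGraph.Walk.mem_support_append_iff] at hx
          rcases hx with hx | hx
          · rintro ⟨hxa, hxb⟩
            -- A node on this stretch mentions `v`; if it mentioned both ends of the edge as well,
            -- its label would have three distinct nulls.
            rcases h2 _ (hlabel x) a c v hne hxa hxb (hq₁ x hx) with h | h
            · exact ha.1 h.symm
            · exact hvc h
          · exact hq₂ x hx
    exact this p rfl
  have hpath := w.bypass_isPath
  cases hw : w.bypass with
  | nil => exact hne rfl
  | cons hadj p =>
    rw [hw, SimpleGraph.Walk.cons_isPath_iff] at hpath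
    obtain ⟨n, hna, hnv, hn⟩ := hedge _ _ hadj
    obtain ⟨u, hu, q, hq⟩ := hwalk p hpath.2 n hnv hn
    obtain ⟨q₁, hq₁⟩ := exists_walk_of_preconnected_induce (hconn a) hna haF
    obtain ⟨q₂, hq₂⟩ := exists_walk_of_preconnected_induce (hconn b) hbF hu
    obtain ⟨x, hx, hxa, hxb⟩ := exists_mem_support_inter hT.isAcyclic hna hu q₁ hq₁ q₂ hq₂ q
    exact hq x hx ⟨hxa, hxb⟩

end SemAc

/-! ### From runs to acyclic equivalents -/

namespace SemAc

/-! ### Two-head runs -/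

/-- A rule `(s, u, v, s')`: in state `s`, the first head reads `u`, the second head reads `v`, and
the state becomes `s'`. -/
abbrev Rule (α : Type) := ℕ × List α × List α × ℕ

/-- From state `0`, the rules lead to the given state while the two heads read the two given
words. -/
inductive Run {α : Type} (R : List (Rule α)) : ℕ → List α → List α → Prop
  | nil : Run R 0 [] []
  | step {s s' : ℕ} {u v U V : List α} :
      Run R s U V → (s, u, v, s') ∈ R → Run R s' (U ++ u) (V ++ v)

/-- The rules use states below `3` and letters below `m`. -/
def RulesBounded (m : ℕ) (R : List (Rule ℕ)) : Prop :=
  ∀ s u v s', (s, u, v, s') ∈ R → s < 3 ∧ s' < 3 ∧ (∀ i ∈ u, i < m) ∧ ∀ i ∈ v, i < m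

theorem Run.letters_lt {m : ℕ} {R : List (Rule ℕ)} (hR : RulesBounded m R) {s : ℕ} {U V : List ℕ}
    (h : Run R s U V) : ∀ i ∈ U, i < m := by
  induction h with
  | nil => simp
  | step _ hr ih =>
    intro i hi
    rcases List.mem_append.1 hi with hi | hi
    · exact ih i hi
    · exact (hR _ _ _ _ hr).2.2.1 i hi

/-! ### The schema, the query and the dependencies -/

/-- A binary atom over variables. -/
def bin (r x y : ℕ) : Atom := (r, [Sum.inr x, Sum.inr y])

/-- A path of atoms through the variables `k, k + 1, …`. -/
def pathAtoms (k : ℕ) (ρ : List ℕ) : List Atom :=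
  (List.range ρ.length).map fun i => bin (ρ.getD i 0) (k + i) (k + i + 1)

/-- The path that encodes a word, as read by the first head. -/
def wordX (u : List ℕ) : List ℕ := u.flatMap fun i => [6 + i, 0, 1, 2]

/-- The path that encodes a word, as read by the second head. -/
def wordY (v : List ℕ) : List ℕ := v.flatMap fun i => [1, 2, 6 + i, 0]

/-- Six auxiliary binary relations, and one for every letter. -/
def wordSchema (m : ℕ) : Schema := List.replicate (6 + m) 2

/-- The atoms of the cyclic query. -/
def cycleAtoms (m : ℕ) : List Atom :=
  bin 1 1 2 :: bin 2 2 0 ::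
    (List.range m).flatMap fun i => [bin (6 + i) 0 (4 + 2 * i), bin 0 (4 + 2 * i) 1]

/-- The cyclic query. -/
def cycleQuery (m : ℕ) : CQ := ([], cycleAtoms m)

/-- Both heads start at the same place. -/
def initTGD : TGD := ([bin 1 1 2, bin 2 2 0], [bin 3 0 1])

/-- The heads move according to a rule. -/
def ruleTGD (ρ : Rule ℕ) : TGD :=
  (bin (3 + ρ.1) 0 (4 * ρ.2.1.length + 1) ::
    (pathAtoms 0 (wordX ρ.2.1) ++ pathAtoms (4 * ρ.2.1.length + 1) (wordY ρ.2.2.1)),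
   [bin (3 + ρ.2.2.2) (4 * ρ.2.1.length) (4 * ρ.2.1.length + 1 + 4 * ρ.2.2.1.length)])

/-- When the heads meet in state `2`, the path is closed to a copy of the cyclic query. -/
def goalTGD (m : ℕ) : TGD :=
  (bin 5 0 1 :: bin 1 1 2 :: bin 2 2 0 ::
    (List.range m).map fun i => bin (6 + i) (3 + 2 * i) (4 + 2 * i), cycleAtoms m)

/-- The dependencies that simulate the rules. -/
def ruleTGDs (m : ℕ) (R : List (Rule ℕ)) : List TGD := initTGD :: goalTGD m :: R.map ruleTGD

theorem hasRel_wordSchema {m r n : ℕ} : (wordSchema m).HasRel r n ↔ r < 6 + m ∧ n = 2 := by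
  simp only [Schema.HasRel, wordSchema, List.getElem?_replicate]
  constructor
  · rintro ⟨h, -⟩
    split at h
    · exact ⟨by assumption, by simpa using h.symm⟩
    · simp at h
  · rintro ⟨h, rfl⟩
    simp [h]

theorem bin_isOver {m r x y : ℕ} (h : r < 6 + m) : (bin r x y).IsOver (wordSchema m) :=
  hasRel_wordSchema.2 ⟨h, rfl⟩

theorem length_wordX (u : List ℕ) : (wordX u).length = 4 * u.length := by
  induction u with
  | nil => rfl
  | cons a u ih => simp only [wordX, List.flatMap_cons, List.length_append] at *; simp [ih]; ring

theorem length_wordY (u : List ℕ) : (wordY u).length = 4 * u.length := by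
  induction u with
  | nil => rfl
  | cons a u ih => simp only [wordY, List.flatMap_cons, List.length_append] at *; simp [ih]; ring

theorem wordX_append (u v : List ℕ) : wordX (u ++ v) = wordX u ++ wordX v := List.flatMap_append

theorem wordY_append (u v : List ℕ) : wordY (u ++ v) = wordY u ++ wordY v := List.flatMap_append

/-- The two encodings read one periodic path from starting points two edges apart. Hence the heads
can stand at the same letter while occupying different vertices, joined by edges 1 and 2. -/
theorem wordY_shift (u : List ℕ) : wordY u ++ [1, 2] = [1, 2] ++ wordX u := by
  induction u with
  | nil => rfl
  | cons a u ih =>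
    have h₁ : wordY (a :: u) = [1, 2, 6 + a, 0] ++ wordY u := rfl
    have h₂ : wordX (a :: u) = [6 + a, 0, 1, 2] ++ wordX u := rfl
    rw [h₁, h₂, List.append_assoc, ih]
    rfl

theorem wordX_injective : Function.Injective wordX := by
  intro u
  induction u with
  | nil =>
    intro v h
    cases v with
    | nil => rfl
    | cons b v => simp [wordX] at h
  | cons a u ih =>
    intro v h
    cases v with
    | nil => simp [wordX] at h
    | cons b v =>
      have h₁ : wordX (a :: u) = [6 + a, 0, 1, 2] ++ wordX u := rfl
      have h₂ : wordX (b :: v) = [6 + b, 0, 1, 2] ++ wordX v := rfl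
      rw [h₁, h₂] at h
      simp at h
      rw [h.1, ih h.2]

/-- The symbols 3, 4, 5, reserved for synchronization, never occur in an encoded word. -/
theorem mem_wordX {m r : ℕ} {u : List ℕ} (hu : ∀ i ∈ u, i < m) (hr : r ∈ wordX u) :
    r < 6 + m ∧ (r < 3 ∨ 6 ≤ r) := by
  simp only [wordX, List.mem_flatMap, List.mem_cons, List.not_mem_nil, or_false] at hr
  obtain ⟨i, hi, h⟩ := hr
  have := hu i hi
  omega

theorem mem_wordY {m r : ℕ} {u : List ℕ} (hu : ∀ i ∈ u, i < m) (hr : r ∈ wordY u) :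
    r < 6 + m ∧ (r < 3 ∨ 6 ≤ r) := by
  simp only [wordY, List.mem_flatMap, List.mem_cons, List.not_mem_nil, or_false] at hr
  obtain ⟨i, hi, h⟩ := hr
  have := hu i hi
  omega

theorem pathAtoms_isOver {m k : ℕ} {ρ : List ℕ} (h : ∀ r ∈ ρ, r < 6 + m) :
    ∀ A ∈ pathAtoms k ρ, A.IsOver (wordSchema m) := by
  intro A hA
  simp only [pathAtoms, List.mem_map, List.mem_range] at hA
  obtain ⟨i, hi, rfl⟩ := hA
  apply bin_isOver
  rw [List.getD_eq_getElem _ _ hi]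
  exact h _ (List.getElem_mem hi)

theorem cycleAtoms_isConjunction (m : ℕ) : IsConjunction (wordSchema m) (cycleAtoms m) := by
  refine ⟨by simp [cycleAtoms], fun A hA => ?_⟩
  simp only [cycleAtoms, List.mem_cons, List.mem_flatMap, List.mem_range, List.not_mem_nil,
    or_false] at hA
  rcases hA with rfl | rfl | ⟨i, hi, rfl | rfl⟩ <;> apply bin_isOver <;> omega

theorem cycleQuery_isOver (m : ℕ) : (cycleQuery m).IsOver (wordSchema m) :=
  ⟨cycleAtoms_isConjunction m, by simp [cycleQuery, CQ.free], by simp [cycleQuery, CQ.free]⟩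

theorem ruleTGDs_isOver {m : ℕ} {R : List (Rule ℕ)} (hR : RulesBounded m R) :
    ∀ τ ∈ ruleTGDs m R, τ.IsOver (wordSchema m) := by
  intro τ hτ
  simp only [ruleTGDs, List.mem_cons, List.mem_map] at hτ
  rcases hτ with rfl | rfl | ⟨⟨s, u, v, s'⟩, hr, rfl⟩
  · refine ⟨⟨by simp [initTGD, TGD.body], fun A hA => ?_⟩, by simp [initTGD, TGD.head],
      fun A hA => ?_⟩
    · simp only [initTGD, TGD.body, List.mem_cons, List.not_mem_nil, or_false] at hA
      rcases hA with rfl | rfl <;> apply bin_isOver <;> omega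
    · simp only [initTGD, TGD.head, List.mem_cons, List.not_mem_nil, or_false] at hA
      subst hA
      apply bin_isOver; omega
  · refine ⟨⟨by simp [goalTGD, TGD.body], fun A hA => ?_⟩, cycleAtoms_isConjunction m⟩
    simp only [goalTGD, TGD.body, List.mem_cons, List.mem_map, List.mem_range] at hA
    rcases hA with rfl | rfl | rfl | ⟨i, hi, rfl⟩ <;> apply bin_isOver <;> omega
  · obtain ⟨hs, hs', hu, hv⟩ := hR _ _ _ _ hr
    refine ⟨⟨by simp [ruleTGD, TGD.body], fun A hA => ?_⟩, by simp [ruleTGD, TGD.head], fun A hA => ?_⟩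
    · simp only [ruleTGD, TGD.body, List.mem_cons, List.mem_append] at hA
      rcases hA with rfl | hA | hA
      · apply bin_isOver; omega
      · exact pathAtoms_isOver (fun r hr => (mem_wordX hu hr).1) A hA
      · exact pathAtoms_isOver (fun r hr => (mem_wordY hv hr).1) A hA
    · simp only [ruleTGD, TGD.head, List.mem_cons, List.not_mem_nil, or_false] at hA
      subst hA
      apply bin_isOver; omega

theorem occurs_bin {x r a b : ℕ} {φ : List Atom} (h : bin r a b ∈ φ) (hx : x = a ∨ x = b) :
    Occurs x φ := ⟨_, h, by simpa [bin] using hx⟩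

theorem occurs_pathAtoms {k : ℕ} {ρ : List ℕ} {φ : List Atom} (h : pathAtoms k ρ ⊆ φ)
    (hρ : ρ ≠ []) : Occurs k φ ∧ Occurs (k + ρ.length) φ := by
  have hl := List.length_pos_of_ne_nil hρ
  constructor
  · exact occurs_bin (h (List.mem_map.2 ⟨0, by simpa using hl, rfl⟩)) (Or.inl rfl)
  · exact occurs_bin (h (List.mem_map.2 ⟨ρ.length - 1, by simpa using hl, rfl⟩))
      (Or.inr (by omega))

theorem ruleTGDs_full (m : ℕ) (R : List (Rule ℕ)) : ruleTGDs m R ∈ FullTGDs := by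
  intro τ hτ
  simp only [ruleTGDs, List.mem_cons, List.mem_map] at hτ
  rcases hτ with rfl | rfl | ⟨⟨s, u, v, s'⟩, hr, rfl⟩
  · rintro x ⟨A, hA, hx⟩
    simp only [initTGD, TGD.head, List.mem_cons, List.not_mem_nil, or_false] at hA
    subst hA
    simp only [bin, List.mem_cons, Sum.inr.injEq, List.not_mem_nil, or_false] at hx
    rcases hx with rfl | rfl
    · exact occurs_bin (r := 2) (a := 2) (b := 0) (by simp [initTGD, TGD.body]) (by simp)
    · exact occurs_bin (r := 1) (a := 1) (b := 2) (by simp [initTGD, TGD.body]) (by simp)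
  · rintro x ⟨A, hA, hx⟩
    have h0 : Occurs 0 (goalTGD m).body := occurs_bin (r := 5) (a := 0) (b := 1)
      (by simp [goalTGD, TGD.body]) (by simp)
    have h1 : Occurs 1 (goalTGD m).body := occurs_bin (r := 5) (a := 0) (b := 1)
      (by simp [goalTGD, TGD.body]) (by simp)
    have h2 : Occurs 2 (goalTGD m).body := occurs_bin (r := 1) (a := 1) (b := 2)
      (by simp [goalTGD, TGD.body]) (by simp)
    have hd : ∀ i < m, Occurs (4 + 2 * i) (goalTGD m).body := fun i hi =>
      occurs_bin (r := 6 + i) (a := 3 + 2 * i) (b := 4 + 2 * i)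
        (by
          simp only [goalTGD, TGD.body, List.mem_cons, List.mem_map, List.mem_range]
          exact Or.inr (Or.inr (Or.inr ⟨i, hi, rfl⟩)))
        (by simp)
    simp only [goalTGD, TGD.head, cycleAtoms, List.mem_cons, List.mem_flatMap, List.mem_range,
      List.not_mem_nil, or_false] at hA
    rcases hA with rfl | rfl | ⟨i, hi, rfl | rfl⟩ <;>
      simp only [bin, List.mem_cons, Sum.inr.injEq, List.not_mem_nil, or_false] at hx <;>
      rcases hx with rfl | rfl <;> first | assumption | exact hd i hi
  · rintro x ⟨A, hA, hx⟩
    simp only [ruleTGD, TGD.head, List.mem_cons, List.not_mem_nil, or_false] at hA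
    subst hA
    simp only [bin, List.mem_cons, Sum.inr.injEq, List.not_mem_nil, or_false] at hx
    have hb : Occurs 0 (ruleTGD (s, u, v, s')).body ∧
        Occurs (4 * u.length + 1) (ruleTGD (s, u, v, s')).body :=
      ⟨occurs_bin (r := 3 + s) (a := 0) (b := 4 * u.length + 1) (by simp [ruleTGD, TGD.body]) (by simp),
       occurs_bin (r := 3 + s) (a := 0) (b := 4 * u.length + 1) (by simp [ruleTGD, TGD.body]) (by simp)⟩
    rcases hx with rfl | rfl
    · by_cases h : wordX u = []
      · have := length_wordX u
        rw [h] at this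
        simp only [List.length_nil] at this
        rw [← this]; exact hb.1
      · have := (occurs_pathAtoms (k := 0) (φ := (ruleTGD (s, u, v, s')).body)
          (fun A hA => by simp [ruleTGD, TGD.body, hA]) h).2
        rwa [length_wordX, Nat.zero_add] at this
    · by_cases h : wordY v = []
      · have := length_wordY v
        rw [h] at this
        simp only [List.length_nil] at this
        rw [← this]; exact hb.2
      · have := (occurs_pathAtoms (k := 4 * u.length + 1) (φ := (ruleTGD (s, u, v, s')).body)
          (fun A hA => by simp [ruleTGD, TGD.body, hA]) h).2
        rwa [length_wordY] at this

/-! ### Chains -/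

/-- The values `f k, f (k + 1), …` form a path with the given relation symbols. -/
def Chain (I : Instance) (f : ℕ → Value) : ℕ → List ℕ → Prop
  | _, [] => True
  | k, r :: ρ => ((r, [f k, f (k + 1)]) : Fact) ∈ I ∧ Chain I f (k + 1) ρ

theorem chain_append {I : Instance} {f : ℕ → Value} {k : ℕ} {ρ ρ' : List ℕ} :
    Chain I f k (ρ ++ ρ') ↔ Chain I f k ρ ∧ Chain I f (k + ρ.length) ρ' := by
  induction ρ generalizing k with
  | nil => simp [Chain]
  | cons r ρ ih =>
    simp only [List.cons_append, Chain, ih, List.length_cons, and_assoc]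
    rw [show k + 1 + ρ.length = k + (ρ.length + 1) by ring]

theorem chain_congr {I : Instance} {f g : ℕ → Value} {k k' : ℕ} {ρ : List ℕ}
    (h : ∀ i ≤ ρ.length, f (k + i) = g (k' + i)) (hc : Chain I f k ρ) : Chain I g k' ρ := by
  induction ρ generalizing k k' with
  | nil => trivial
  | cons r ρ ih =>
    refine ⟨?_, ih (fun i hi => ?_) hc.2⟩
    · have h0 := h 0 (by simp)
      have h1 := h 1 (by simp)
      rw [Nat.add_zero, Nat.add_zero] at h0
      rw [← h0, ← h1]
      exact hc.1
    · have := h (i + 1) (by simpa using hi)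
      rwa [show k + 1 + i = k + (i + 1) by ring, show k' + 1 + i = k' + (i + 1) by ring]

theorem pathAtoms_cons (k r : ℕ) (ρ : List ℕ) :
    pathAtoms k (r :: ρ) = bin r k (k + 1) :: pathAtoms (k + 1) ρ := by
  simp only [pathAtoms, List.length_cons, List.range_succ_eq_map, List.map_cons, List.map_map]
  congr 1
  apply List.map_congr_left
  intro i _
  simp only [Function.comp, List.getD_cons_succ]
  rw [show k + 1 + i = k + i.succ by simp; ring]

theorem isHom_pathAtoms {I : Instance} {f : ℕ → Value} {k : ℕ} {ρ : List ℕ} :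
    IsHom f (pathAtoms k ρ) I ↔ Chain I f k ρ := by
  induction ρ generalizing k with
  | nil => simp [IsHom, pathAtoms, Chain]
  | cons r ρ ih =>
    rw [pathAtoms_cons, Chain, ← ih]
    simp only [IsHom, List.mem_cons, forall_eq_or_imp]
    rfl

theorem exists_of_chain {I : Instance} {f : ℕ → Value} {k r : ℕ} {ρ : List ℕ}
    (h : Chain I f k ρ) (hr : r ∈ ρ) : ∃ j, ((r, [f j, f (j + 1)]) : Fact) ∈ I := by
  induction ρ generalizing k with
  | nil => simp at hr
  | cons r' ρ ih =>
    rcases List.mem_cons.1 hr with rfl | hr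
    · exact ⟨k, h.1⟩
    · exact ih h.2 hr

/-! ### The acyclic query given by a run -/

/-- The path query that encodes a word. -/
def pathQuery (ρ : List ℕ) : CQ := ([], pathAtoms 0 ρ)

/-- Once the edge from `u` to `u + 1` is removed, no walk starting at or below `u` gets above it, so
every edge is a bridge. -/
theorem pathGraph_isTree (n : ℕ) : (SimpleGraph.pathGraph (n + 1)).IsTree := by
  refine ⟨SimpleGraph.pathGraph_connected n, ?_⟩
  rw [SimpleGraph.isAcyclic_iff_forall_adj_isBridge]
  have key : ∀ u v : Fin (n + 1), (u : ℕ) + 1 = v →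
      ¬ (SimpleGraph.pathGraph (n + 1) \ SimpleGraph.fromEdgeSet {s(u, v)}).Reachable u v := by
    rintro u v huv ⟨p⟩
    have hle : ∀ {a b : Fin (n + 1)},
        (SimpleGraph.pathGraph (n + 1) \ SimpleGraph.fromEdgeSet {s(u, v)}).Walk a b →
        (a : ℕ) ≤ u → (b : ℕ) ≤ u := by
      intro a b p
      induction p with
      | nil => exact id
      | @cons a c b hadj p ih =>
        intro ha
        refine ih ?_
        rw [SimpleGraph.sdiff_adj, SimpleGraph.pathGraph_adj, SimpleGraph.fromEdgeSet_adj] at hadj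
        by_contra hc
        refine hadj.2 ⟨?_, fun h => hc (h ▸ ha)⟩
        have h₁ : a = u := Fin.ext (by omega)
        have h₂ : c = v := Fin.ext (by omega)
        rw [h₁, h₂]
        rfl
    have := hle p le_rfl
    omega
  intro u v huv
  rw [SimpleGraph.isBridge_iff]
  rcases SimpleGraph.pathGraph_adj.1 huv with h | h
  · exact key u v h
  · rw [Sym2.eq_swap]
    exact fun hr => key v u h hr.symm

/-- The join tree is the path of atoms in their order; a variable occurs only in the two consecutive
atoms around it. -/
theorem pathQuery_isAcyclic {ρ : List ℕ} (hρ : ρ ≠ []) : (pathQuery ρ).IsAcyclic := by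
  obtain ⟨n, hn⟩ := Nat.exists_eq_succ_of_ne_zero (List.length_pos_of_ne_nil hρ).ne'
  refine ⟨Fin (n + 1), SimpleGraph.pathGraph (n + 1),
    fun i => bin (ρ.getD i 0) i (i + 1), pathGraph_isTree n, ?_, ?_, ?_⟩
  · intro i
    refine ⟨bin (ρ.getD i 0) (0 + i) (0 + i + 1), List.mem_map.2 ⟨i, ?_, rfl⟩, ?_⟩
    · rw [List.mem_range, hn]; exact i.2
    · rw [Atom.apply_inr, Nat.zero_add]
  · rintro F ⟨A, hA, rfl⟩
    simp only [CQ.atoms, pathQuery, pathAtoms, List.mem_map, List.mem_range, Nat.zero_add] at hA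
    obtain ⟨i, hi, rfl⟩ := hA
    rw [hn] at hi
    exact ⟨⟨i, hi⟩, (Atom.apply_inr _).symm⟩
  · rintro x ⟨i, hi⟩ ⟨j, hj⟩
    simp only [bin, Set.mem_ofPred_eq, List.mem_cons, Sum.inr.injEq, List.not_mem_nil,
      or_false] at hi hj
    by_cases hij : i = j
    · subst hij; exact SimpleGraph.Reachable.rfl
    · apply SimpleGraph.Adj.reachable
      rw [SimpleGraph.induce_adj, SimpleGraph.pathGraph_adj]
      have : (i : ℕ) ≠ j := fun h => hij (Fin.ext h)
      show (i : ℕ) + 1 = j ∨ (j : ℕ) + 1 = i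
      have hi' : x = (i : ℕ) ∨ x = (i : ℕ) + 1 := hi
      have hj' : x = (j : ℕ) ∨ x = (j : ℕ) + 1 := hj
      clear hi hj
      grind

/-- Each letter is one turn around the cycle, from `h 1` back to `h 1`; a word is a sequence of
turns. -/
theorem chain_of_cycle {m : ℕ} {I : Instance} {h : Var → Value}
    (hh : IsHom h (cycleAtoms m) I) {U : List ℕ} (hU : ∀ i ∈ U, i < m) :
    ∃ f : ℕ → Value, Chain I f 0 (wordY U ++ [1, 2]) := by
  have h1 : ((1, [h 1, h 2]) : Fact) ∈ I := hh (bin 1 1 2) (by simp [cycleAtoms])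
  have h2 : ((2, [h 2, h 0]) : Fact) ∈ I := hh (bin 2 2 0) (by simp [cycleAtoms])
  have hP : ∀ i < m, ((6 + i, [h 0, h (4 + 2 * i)]) : Fact) ∈ I := fun i hi =>
    hh (bin (6 + i) 0 (4 + 2 * i)) (by
      simp only [cycleAtoms, List.mem_cons, List.mem_flatMap, List.mem_range]
      exact Or.inr (Or.inr ⟨i, hi, by simp⟩))
  have hQ : ∀ i < m, ((0, [h (4 + 2 * i), h 1]) : Fact) ∈ I := fun i hi =>
    hh (bin 0 (4 + 2 * i) 1) (by
      simp only [cycleAtoms, List.mem_cons, List.mem_flatMap, List.mem_range]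
      exact Or.inr (Or.inr ⟨i, hi, by simp⟩))
  suffices H : ∃ f : ℕ → Value, f 0 = h 1 ∧ Chain I f 0 (wordY U ++ [1, 2]) from
    H.imp fun _ => And.right
  induction U with
  | nil =>
    refine ⟨fun i => if i = 0 then h 1 else if i = 1 then h 2 else h 0, by simp, ?_⟩
    simp [wordY, Chain, h1, h2]
  | cons a U ih =>
    obtain ⟨f, hf, hc⟩ := ih fun i hi => hU i (by simp [hi])
    have ha := hU a (by simp)
    -- One turn through the vertex of the letter `a`, then the chain for `U` shifted by four.
    refine ⟨fun i => if i = 0 then h 1 else if i = 1 then h 2 else if i = 2 then h 0 else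
      if i = 3 then h (4 + 2 * a) else f (i - 4), by simp, ?_⟩
    have e : wordY (a :: U) ++ [1, 2] = [1, 2, 6 + a, 0] ++ (wordY U ++ [1, 2]) := by
      simp [wordY]
    rw [e, chain_append]
    refine ⟨by simp [Chain, h1, h2, hP a ha, hQ a ha, hf], ?_⟩
    refine chain_congr (fun i _ => ?_) hc
    simp only [List.length_cons, List.length_nil]
    rw [if_neg (by omega), if_neg (by omega), if_neg (by omega), if_neg (by omega)]
    congr 1
    omega

/-- A letter takes four edges, and the first head reads from offset 2 (`wordY_shift`). The prefix
conditions ensure that each rule finds on the path the words that it reads. -/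
theorem sync_of_run {m : ℕ} {R : List (Rule ℕ)} {I : Instance} (hI : Models I (ruleTGDs m R))
    {f : ℕ → Value} {W : List ℕ} (hc : Chain I f 0 (wordY W ++ [1, 2])) {s : ℕ} {U V : List ℕ}
    (h : Run R s U V) (hU : U <+: W) (hV : V <+: W) :
    ((3 + s, [f (4 * U.length + 2), f (4 * V.length)]) : Fact) ∈ I := by
  induction h with
  | nil =>
    rw [wordY_shift, chain_append] at hc
    obtain ⟨⟨h₁, h₂, -⟩, -⟩ := hc
    have := (hI initTGD (by simp [ruleTGDs])).isHom_head (ruleTGDs_full m R _ (by simp [ruleTGDs]))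
      (h := fun i => if i = 0 then f 2 else if i = 1 then f 0 else f 1) (fun A hA => by
        simp only [initTGD, TGD.body, List.mem_cons, List.not_mem_nil, or_false] at hA
        rcases hA with rfl | rfl
        · exact h₁
        · exact h₂)
    exact this (bin 3 0 1) (by simp [initTGD, TGD.head])
  | @step s s' u v U V _ hr ih =>
    have hs := ih ((List.prefix_append _ _).trans hU) ((List.prefix_append _ _).trans hV)
    have hX : Chain I f (4 * U.length + 2) (wordX u) := by
      obtain ⟨W', rfl⟩ := hU
      rw [wordY_shift, wordX_append, wordX_append, chain_append, chain_append, chain_append] at hc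
      have := hc.2.1.2
      rwa [length_wordX, show 0 + [1, 2].length + 4 * U.length = 4 * U.length + 2 by simp; ring]
        at this
    have hY : Chain I f (4 * V.length) (wordY v) := by
      obtain ⟨W', rfl⟩ := hV
      rw [wordY_append, wordY_append, chain_append, chain_append, chain_append] at hc
      have := hc.1.1.2
      rwa [length_wordY, Nat.zero_add] at this
    -- The variables up to `4 * u.length` follow the first head, the later ones the second.
    let h : ℕ → Value := fun j => if j ≤ 4 * u.length then f (4 * U.length + 2 + j) else
      f (4 * V.length + (j - (4 * u.length + 1)))
    have hmem : ruleTGD (s, u, v, s') ∈ ruleTGDs m R := by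
      simp only [ruleTGDs, List.mem_cons, List.mem_map]
      exact Or.inr (Or.inr ⟨_, hr, rfl⟩)
    have hb : IsHom h (ruleTGD (s, u, v, s')).body I := by
      intro A hA
      simp only [ruleTGD, TGD.body, List.mem_cons, List.mem_append] at hA
      rcases hA with rfl | hA | hA
      · have e₁ : h 0 = f (4 * U.length + 2) := by simp [h]
        have e₂ : h (4 * u.length + 1) = f (4 * V.length) := by simp [h]
        show ((3 + s, [h 0, h (4 * u.length + 1)]) : Fact) ∈ I
        rw [e₁, e₂]
        exact hs
      · refine isHom_pathAtoms.2 (chain_congr (fun i hi => ?_) hX) A hA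
        rw [length_wordX] at hi
        simp [h, hi]
      · refine isHom_pathAtoms.2 (chain_congr (fun i hi => ?_) hY) A hA
        simp only [h]
        rw [if_neg (by omega)]
        congr 1
        omega
    have := (hI _ hmem).isHom_head (ruleTGDs_full m R _ hmem) hb
      (bin (3 + s') (4 * u.length) (4 * u.length + 1 + 4 * v.length)) (by simp [ruleTGD, TGD.head])
    have e₁ : h (4 * u.length) = f (4 * (U ++ u).length + 2) := by
      simp only [h, le_refl, if_true, List.length_append]
      congr 1; ring
    have e₂ : h (4 * u.length + 1 + 4 * v.length) = f (4 * (V ++ v).length) := by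
      simp only [h, List.length_append]
      rw [if_neg (by omega)]
      congr 1; omega
    rw [← e₁, ← e₂]
    exact this

theorem semanticallyAcyclic_of_run {m : ℕ} {R : List (Rule ℕ)} (hR : RulesBounded m R) {U : List ℕ}
    (h : Run R 2 U U) :
    SemanticallyAcyclic (wordSchema m) (ruleTGDs m R) (cycleQuery m) := by
  have hU := h.letters_lt hR
  -- The appended letters supply the atom for every letter that the body of `goalTGD` requires.
  let W := U ++ List.range m
  have hW : ∀ i ∈ W, i < m := fun i hi => by
    rcases List.mem_append.1 hi with hi | hi
    · exact hU i hi
    · exact List.mem_range.1 hi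
  have hne : wordY W ++ [1, 2] ≠ [] := by simp
  refine ⟨pathQuery (wordY W ++ [1, 2]), ⟨⟨?_, ?_⟩, by simp [pathQuery, CQ.free], by simp [pathQuery, CQ.free]⟩,
    pathQuery_isAcyclic hne, ?_, ?_⟩
  · simp [pathQuery, CQ.atoms, pathAtoms]
  · refine pathAtoms_isOver fun r hr => ?_
    rcases List.mem_append.1 hr with hr | hr
    · exact (mem_wordY hW hr).1
    · simp at hr; omega
  · rintro I - - _ ⟨k, hk, rfl⟩
    obtain ⟨f, hf⟩ := chain_of_cycle hk hW
    exact ⟨f, isHom_pathAtoms.2 hf, rfl⟩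
  · rintro I - hI _ ⟨f, hf, rfl⟩
    have hc := isHom_pathAtoms.1 hf
    have hs := sync_of_run hI hc h (List.prefix_append _ _) (List.prefix_append _ _)
    have hRT : Chain I f (4 * U.length) [1, 2] := by
      have hc' := hc
      rw [wordY_shift, wordX_append, ← List.append_assoc, ← wordY_shift, chain_append,
        chain_append, length_wordY, Nat.zero_add] at hc'
      exact hc'.1.2
    have hl : ∀ i < m, ∃ j, ((6 + i, [f j, f (j + 1)]) : Fact) ∈ I := fun i hi =>
      exists_of_chain hc (List.mem_append.2 (Or.inl (List.mem_flatMap.2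
        ⟨i, List.mem_append.2 (Or.inr (List.mem_range.2 hi)), by simp⟩)))
    choose! j hj using hl
    -- Variables 0, 1, 2 go to the meeting place of the heads; `3 + 2 * i` and `4 + 2 * i` go to the
    -- ends of some edge for the letter `i`.
    let g : ℕ → Value := fun x => if x = 0 then f (4 * U.length + 2) else
      if x = 1 then f (4 * U.length) else if x = 2 then f (4 * U.length + 1) else
      if x % 2 = 1 then f (j ((x - 3) / 2)) else f (j ((x - 4) / 2) + 1)
    have hmem : goalTGD m ∈ ruleTGDs m R := by simp [ruleTGDs]
    refine ⟨g, (hI _ hmem).isHom_head (ruleTGDs_full m R _ hmem) ?_, rfl⟩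
    intro A hA
    simp only [goalTGD, TGD.body, List.mem_cons, List.mem_map, List.mem_range] at hA
    rcases hA with rfl | rfl | rfl | ⟨i, hi, rfl⟩
    · exact hs
    · exact hRT.1
    · exact hRT.2.1
    · have e₁ : g (3 + 2 * i) = f (j i) := by
        simp only [g]
        rw [if_neg (by omega), if_neg (by omega), if_neg (by omega), if_pos (by omega)]
        congr 2; omega
      have e₂ : g (4 + 2 * i) = f (j i + 1) := by
        simp only [g]
        rw [if_neg (by omega), if_neg (by omega), if_neg (by omega), if_neg (by omega)]
        congr 3; omega
      show ((6 + i, [g (3 + 2 * i), g (4 + 2 * i)]) : Fact) ∈ I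
      rw [e₁, e₂]
      exact hj i hi

end SemAc

/-! ### From acyclic equivalents back to runs -/

namespace SemAc

/-! ### Walks labelled by relation symbols -/

/-- A directed walk whose steps use the given relation symbols. -/
def LabelWalk {V : Type} (E : ℕ → V → V → Prop) : List ℕ → V → V → Prop
  | [], a, b => a = b
  | r :: ρ, a, b => ∃ c, E r a c ∧ LabelWalk E ρ c b

theorem LabelWalk.append {V : Type} {E : ℕ → V → V → Prop} {ρ ρ' : List ℕ} {a b c : V}
    (h : LabelWalk E ρ a b) (h' : LabelWalk E ρ' b c) : LabelWalk E (ρ ++ ρ') a c := by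
  induction ρ generalizing a with
  | nil => cases h; exact h'
  | cons r ρ ih =>
    obtain ⟨d, hd, h⟩ := h
    exact ⟨d, hd, ih h⟩

theorem LabelWalk.of_chain {I : Instance} {E : ℕ → Value → Value → Prop}
    (hE : ∀ r a b, ((r, [a, b]) : Fact) ∈ I → E r a b) {f : ℕ → Value} {k : ℕ} {ρ : List ℕ}
    (h : Chain I f k ρ) : LabelWalk E ρ (f k) (f (k + ρ.length)) := by
  induction ρ generalizing k with
  | nil => rfl
  | cons r ρ ih =>
    refine ⟨f (k + 1), hE _ _ _ h.1, ?_⟩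
    have := ih h.2
    rwa [show k + 1 + ρ.length = k + (r :: ρ).length by simp; ring] at this

/-! ### The model of the dependencies over the cyclic query -/

/-- The facts of the model: the cyclic query and all synchronization facts of its position. -/
inductive CycleRel (m : ℕ) : ℕ → ℕ → ℕ → Prop
  | r : CycleRel m 1 1 2
  | t : CycleRel m 2 2 0
  | letter (i : ℕ) (h : i < m) : CycleRel m (6 + i) 0 (4 + 2 * i)
  | back (i : ℕ) (h : i < m) : CycleRel m 0 (4 + 2 * i) 1
  | sync (s : ℕ) (h : s < 3) : CycleRel m (3 + s) 0 1

/-- The model as an instance. -/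
def cycleModel (m : ℕ) : Instance :=
  {F | ∃ r a b, CycleRel m r a b ∧ F = (r, [Sum.inr a, Sum.inr b])}

theorem mem_cycleModel {m r : ℕ} {x y : Value} (h : ((r, [x, y]) : Fact) ∈ cycleModel m) :
    ∃ a b, CycleRel m r a b ∧ x = Sum.inr a ∧ y = Sum.inr b := by
  obtain ⟨r', a, b, h, e⟩ := h
  simp only [Prod.mk.injEq, List.cons.injEq, and_true] at e
  obtain ⟨rfl, rfl, rfl⟩ := e
  exact ⟨a, b, h, rfl, rfl⟩

theorem cycleRel_one {m a b : ℕ} (h : CycleRel m 1 a b) : a = 1 ∧ b = 2 := by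
  generalize hr : 1 = r at h
  cases h <;> first | exact ⟨rfl, rfl⟩ | omega

theorem cycleRel_two {m a b : ℕ} (h : CycleRel m 2 a b) : a = 2 ∧ b = 0 := by
  generalize hr : 2 = r at h
  cases h <;> first | exact ⟨rfl, rfl⟩ | omega

theorem cycleRel_zero {m a b : ℕ} (h : CycleRel m 0 a b) : b = 1 := by
  generalize hr : 0 = r at h
  cases h <;> omega

theorem cycleRel_letter {m i a b : ℕ} (h : CycleRel m (6 + i) a b) : a = 0 ∧ b = 4 + 2 * i := by
  generalize hr : 6 + i = r at h
  cases h <;> omega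

theorem cycleRel_sync {m s a b : ℕ} (hs : s < 3) (h : CycleRel m (3 + s) a b) :
    a = 0 ∧ b = 1 := by
  generalize hr : 3 + s = r at h
  cases h <;> omega

/-- Every block of the encoding ends with an edge 2, and these all end at 0. -/
theorem labelWalk_wordX {m : ℕ} {u : List ℕ} {b : ℕ}
    (h : LabelWalk (CycleRel m) (wordX u) 0 b) : b = 0 := by
  induction u with
  | nil => exact h.symm
  | cons i u ih =>
    obtain ⟨c₁, h₁, c₂, h₂, c₃, h₃, c₄, h₄, h⟩ := h
    obtain rfl := (cycleRel_two h₄).2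
    exact ih h

theorem labelWalk_wordY {m : ℕ} {u : List ℕ} {b : ℕ}
    (h : LabelWalk (CycleRel m) (wordY u) 1 b) : b = 1 := by
  induction u with
  | nil => exact h.symm
  | cons i u ih =>
    obtain ⟨c₁, h₁, c₂, h₂, c₃, h₃, c₄, h₄, h⟩ := h
    obtain rfl := cycleRel_zero h₄
    exact ih h

theorem labelWalk_cycleModel {m : ℕ} {ρ : List ℕ} {x y : Value} {a : ℕ}
    (h : LabelWalk (fun r x y => ((r, [x, y]) : Fact) ∈ cycleModel m) ρ x y)
    (hx : x = Sum.inr a) : ∃ b, y = Sum.inr b ∧ LabelWalk (CycleRel m) ρ a b := by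
  induction ρ generalizing x a with
  | nil => exact ⟨a, h ▸ hx, rfl⟩
  | cons r ρ ih =>
    obtain ⟨c, hc, h⟩ := h
    obtain ⟨a', c', hr, rfl, rfl⟩ := mem_cycleModel hc
    obtain ⟨b, hb, hw⟩ := ih h rfl
    cases hx
    exact ⟨b, hb, c', hr, hw⟩

theorem isHom_cycleAtoms {m : ℕ} {I : Instance} {h : Var → Value} :
    IsHom h (cycleAtoms m) I ↔ ((1, [h 1, h 2]) : Fact) ∈ I ∧ ((2, [h 2, h 0]) : Fact) ∈ I ∧
      ∀ i < m, ((6 + i, [h 0, h (4 + 2 * i)]) : Fact) ∈ I ∧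
        ((0, [h (4 + 2 * i), h 1]) : Fact) ∈ I := by
  constructor
  · intro H
    refine ⟨H (bin 1 1 2) (by simp [cycleAtoms]), H (bin 2 2 0) (by simp [cycleAtoms]),
      fun i hi => ⟨H (bin (6 + i) 0 (4 + 2 * i)) ?_, H (bin 0 (4 + 2 * i) 1) ?_⟩⟩ <;>
    · simp only [cycleAtoms, List.mem_cons, List.mem_flatMap, List.mem_range]
      exact Or.inr (Or.inr ⟨i, hi, by simp⟩)
  · rintro ⟨h₁, h₂, h₃⟩ A hA
    simp only [cycleAtoms, List.mem_cons, List.mem_flatMap, List.mem_range, List.not_mem_nil,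
      or_false] at hA
    rcases hA with rfl | rfl | ⟨i, hi, rfl | rfl⟩
    · exact h₁
    · exact h₂
    · exact (h₃ i hi).1
    · exact (h₃ i hi).2

/-- What it means for a rule to be triggered. -/
theorem isHom_ruleTGD_body {s s' : ℕ} {u v : List ℕ} {I : Instance} {h : Var → Value}
    (H : IsHom h (ruleTGD (s, u, v, s')).body I) :
    ((3 + s, [h 0, h (4 * u.length + 1)]) : Fact) ∈ I ∧
      LabelWalk (fun r x y => ((r, [x, y]) : Fact) ∈ I) (wordX u) (h 0) (h (4 * u.length)) ∧
      LabelWalk (fun r x y => ((r, [x, y]) : Fact) ∈ I) (wordY v) (h (4 * u.length + 1))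
        (h (4 * u.length + 1 + 4 * v.length)) := by
  refine ⟨H (bin (3 + s) 0 (4 * u.length + 1)) (by simp [ruleTGD, TGD.body]), ?_, ?_⟩
  · have := LabelWalk.of_chain (E := fun r x y => ((r, [x, y]) : Fact) ∈ I) (fun _ _ _ h => h)
      ((isHom_pathAtoms (f := h) (k := 0) (ρ := wordX u)).1
        fun A hA => H A (by simp [ruleTGD, TGD.body, hA]))
    rwa [length_wordX, Nat.zero_add] at this
  · have := LabelWalk.of_chain (E := fun r x y => ((r, [x, y]) : Fact) ∈ I) (fun _ _ _ h => h)
      ((isHom_pathAtoms (f := h) (k := 4 * u.length + 1) (ρ := wordY v)).1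
        fun A hA => H A (by simp [ruleTGD, TGD.body, hA]))
    rwa [length_wordY] at this

theorem cycleModel_isOver (m : ℕ) : (cycleModel m).IsOver (wordSchema m) := by
  rintro F ⟨r, a, b, h, rfl⟩
  refine hasRel_wordSchema.2 ⟨?_, rfl⟩
  cases h <;> simp only <;> omega

theorem isHom_cycleModel (m : ℕ) : IsHom Sum.inr (cycleAtoms m) (cycleModel m) :=
  isHom_cycleAtoms.2 ⟨⟨_, _, _, .r, rfl⟩, ⟨_, _, _, .t, rfl⟩, fun i hi =>
    ⟨⟨_, _, _, .letter i hi, rfl⟩, ⟨_, _, _, .back i hi, rfl⟩⟩⟩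

/-- Over the cycle the first head is always at 0 and the second at 1, and all synchronization facts
there are present. The head of `goalTGD` adds nothing, since every edge for the letter `i` already
ends at `4 + 2 * i`. -/
theorem models_cycleModel {m : ℕ} {R : List (Rule ℕ)} (hR : RulesBounded m R) :
    Models (cycleModel m) (ruleTGDs m R) := by
  intro τ hτ
  refine TGD.holds_of_isHom_head fun h hb => ?_
  simp only [ruleTGDs, List.mem_cons, List.mem_map] at hτ
  rcases hτ with rfl | rfl | ⟨⟨s, u, v, s'⟩, hr, rfl⟩
  · have h₁ : ((1, [h 1, h 2]) : Fact) ∈ cycleModel m :=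
      hb (bin 1 1 2) (by simp [initTGD, TGD.body])
    have h₂ : ((2, [h 2, h 0]) : Fact) ∈ cycleModel m :=
      hb (bin 2 2 0) (by simp [initTGD, TGD.body])
    obtain ⟨a, b, hab, e₁, -⟩ := mem_cycleModel h₁
    obtain ⟨c, d, hcd, -, e₂⟩ := mem_cycleModel h₂
    intro A hA
    simp only [initTGD, TGD.head, List.mem_cons, List.not_mem_nil, or_false] at hA
    subst hA
    refine ⟨3, 0, 1, .sync 0 (by omega), ?_⟩
    show ((3, [h 0, h 1]) : Fact) = _
    rw [e₁, e₂, (cycleRel_one hab).1, (cycleRel_two hcd).2]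
  · have h₁ : ((1, [h 1, h 2]) : Fact) ∈ cycleModel m :=
      hb (bin 1 1 2) (by simp [goalTGD, TGD.body])
    have h₂ : ((2, [h 2, h 0]) : Fact) ∈ cycleModel m :=
      hb (bin 2 2 0) (by simp [goalTGD, TGD.body])
    obtain ⟨a, b, hab, e₁, -⟩ := mem_cycleModel h₁
    obtain ⟨c, d, hcd, -, e₂⟩ := mem_cycleModel h₂
    obtain rfl := (cycleRel_one hab).1
    obtain rfl := (cycleRel_two hcd).2
    refine isHom_cycleAtoms.2 ⟨h₁, h₂, fun i hi => ?_⟩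
    have h₃ : ((6 + i, [h (3 + 2 * i), h (4 + 2 * i)]) : Fact) ∈ cycleModel m :=
      hb (bin (6 + i) (3 + 2 * i) (4 + 2 * i)) (by
        simp only [goalTGD, TGD.body, List.mem_cons, List.mem_map, List.mem_range]
        exact Or.inr (Or.inr (Or.inr ⟨i, hi, rfl⟩)))
    obtain ⟨a', b', hab', -, e₃⟩ := mem_cycleModel h₃
    obtain rfl := (cycleRel_letter hab').2
    rw [e₁, e₂, e₃]
    exact ⟨⟨_, _, _, .letter i hi, rfl⟩, ⟨_, _, _, .back i hi, rfl⟩⟩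
  · obtain ⟨hs, hX, hY⟩ := isHom_ruleTGD_body hb
    obtain ⟨hs₁, hs₂, -, -⟩ := hR _ _ _ _ hr
    obtain ⟨a, b, hab, e₁, e₂⟩ := mem_cycleModel hs
    obtain ⟨rfl, rfl⟩ := cycleRel_sync hs₁ hab
    obtain ⟨c, e₃, hX⟩ := labelWalk_cycleModel hX e₁
    obtain ⟨d, e₄, hY⟩ := labelWalk_cycleModel hY e₂
    obtain rfl := labelWalk_wordX hX
    obtain rfl := labelWalk_wordY hY
    intro A hA
    simp only [ruleTGD, TGD.head, List.mem_cons, List.not_mem_nil, or_false] at hA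
    subst hA
    refine ⟨3 + s', 0, 1, .sync s' hs₂, ?_⟩
    show ((3 + s', [h (4 * u.length), h (4 * u.length + 1 + 4 * v.length)]) : Fact) = _
    rw [e₃, e₄]

/-! ### Walks in an acyclic graph that maps to the model -/

/-- The relation symbols of the path structure. -/
def IsPathRel (r : ℕ) : Prop := r < 3 ∨ 6 ≤ r

/-- The position of a vertex of the model on its cycle. -/
def phase (a : ℕ) : ℕ := if a = 1 then 0 else if a = 2 then 1 else if a = 0 then 2 else 3

/-- This excludes loops and backtracking in any graph that maps to the model. -/
theorem CycleRel.phase_succ {m r a b : ℕ} (h : CycleRel m r a b) (hr : IsPathRel r) :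
    phase b % 4 = (phase a + 1) % 4 := by
  cases h with
  | r => rfl
  | t => rfl
  | letter i h =>
    simp only [phase]
    rw [if_neg (by omega), if_neg (by omega), if_neg (by omega)]; rfl
  | back i h =>
    simp only [phase]
    rw [if_neg (by omega : ¬ 4 + 2 * i = 1), if_neg (by omega : ¬ 4 + 2 * i = 2),
      if_neg (by omega : ¬ 4 + 2 * i = 0)]; rfl
  | sync s h => unfold IsPathRel at hr; omega

/-- The phases differ by two, so a synchronization edge never shares both ends with a path edge, in
either direction. -/
theorem CycleRel.phase_sync {m s a b : ℕ} (hs : s < 3) (h : CycleRel m (3 + s) a b) :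
    phase b = 0 ∧ phase a = 2 := by
  obtain ⟨rfl, rfl⟩ := cycleRel_sync hs h
  exact ⟨rfl, rfl⟩

theorem CycleRel.label_unique {m r r' a b : ℕ} (h : CycleRel m r a b) (hr : IsPathRel r)
    (h' : CycleRel m r' a b) (hr' : IsPathRel r') : r = r' := by
  unfold IsPathRel at hr hr'
  generalize ha : a = a' at h'
  generalize hb : b = b' at h'
  cases h <;> cases h' <;> omega

section Forest

variable {V : Type} {m : ℕ} {E : ℕ → V → V → Prop} {col : V → ℕ} {G : SimpleGraph V}

/-- A labelled walk that maps to the model is a path of the forest. -/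
theorem exists_path_of_labelWalk (hG : G.IsAcyclic)
    (hcol : ∀ r a b, E r a b → CycleRel m r (col a) (col b))
    (hadj : ∀ r a b, E r a b → a ≠ b → G.Adj a b) {ρ : List ℕ} (hρ : ∀ r ∈ ρ, IsPathRel r)
    {a b : V} (h : LabelWalk E ρ a b) :
    ∃ p : G.Walk a b, p.IsPath ∧ p.length = ρ.length ∧
      ∀ i (hi : i < ρ.length), E ρ[i] (p.getVert i) (p.getVert (i + 1)) := by
  -- In a forest a walk is a path as soon as consecutive edges differ. The induction also records
  -- the phase at the end of the first edge.
  suffices H : ∃ p : G.Walk a b, List.IsChain (· ≠ ·) p.edges ∧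
      (∀ e ∈ p.edges.head?, ∃ c, e = s(a, c) ∧ phase (col c) % 4 = (phase (col a) + 1) % 4) ∧
      p.length = ρ.length ∧
      ∀ i (hi : i < ρ.length), E ρ[i] (p.getVert i) (p.getVert (i + 1)) by
    obtain ⟨p, h₁, -, h₂, h₃⟩ := H
    exact ⟨p, (hG.isPath_iff_isChain p).2 h₁, h₂, h₃⟩
  induction ρ generalizing a with
  | nil =>
    cases h
    exact ⟨SimpleGraph.Walk.nil, by simp, by simp, by simp, by simp⟩
  | cons r ρ ih =>
    obtain ⟨c, hc, h⟩ := h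
    have hr := hρ r (by simp)
    have hph := (hcol _ _ _ hc).phase_succ hr
    have hne : a ≠ c := by
      rintro rfl
      omega
    obtain ⟨p, h₁, h₂, h₃, h₄⟩ := ih (fun r hr => hρ r (by simp [hr])) h
    refine ⟨SimpleGraph.Walk.cons (hadj _ _ _ hc hne) p, ?_, ?_, by simp [h₃], ?_⟩
    · rw [SimpleGraph.Walk.edges_cons, List.isChain_cons]
      refine ⟨fun e he hee => ?_, h₁⟩
      obtain ⟨d, rfl, hd⟩ := h₂ e he
      rw [Sym2.eq_iff] at hee
      -- Turning back would return to the same vertex with its phase raised by two modulo 4.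
      rcases hee with ⟨rfl, -⟩ | ⟨rfl, -⟩
      · exact hne rfl
      · omega
    · intro e he
      simp only [SimpleGraph.Walk.edges_cons, List.head?_cons, Option.mem_def,
        Option.some.injEq] at he
      exact ⟨c, he.symm, hph⟩
    · rintro (_ | i) hi
      · simpa using hc
      · simpa using h₄ i (by simpa using hi)

/-- Both walks follow the unique path between the endpoints, and the colours of the ends of an edge
determine its path label. -/
theorem labelWalk_unique (hG : G.IsAcyclic)
    (hcol : ∀ r a b, E r a b → CycleRel m r (col a) (col b))
    (hadj : ∀ r a b, E r a b → a ≠ b → G.Adj a b) {ρ ρ' : List ℕ}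
    (hρ : ∀ r ∈ ρ, IsPathRel r) (hρ' : ∀ r ∈ ρ', IsPathRel r) {a b : V}
    (h : LabelWalk E ρ a b) (h' : LabelWalk E ρ' a b) : ρ = ρ' := by
  obtain ⟨p, hp, hl, hE⟩ := exists_path_of_labelWalk hG hcol hadj hρ h
  obtain ⟨p', hp', hl', hE'⟩ := exists_path_of_labelWalk hG hcol hadj hρ' h'
  have hpp : p = p' := congrArg Subtype.val ((hG.subsingleton_path a b).elim ⟨p, hp⟩ ⟨p', hp'⟩)
  subst hpp
  refine List.ext_getElem (hl ▸ hl') fun i hi hi' => ?_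
  exact (hcol _ _ _ (hE i hi)).label_unique (hρ _ (List.getElem_mem hi)) (hcol _ _ _ (hE' i hi'))
    (hρ' _ (List.getElem_mem hi'))

/-- The endpoints of a synchronization edge are not connected by the path structure. -/
theorem not_reachable_of_sync (hG : G.IsAcyclic)
    (hcol : ∀ r a b, E r a b → CycleRel m r (col a) (col b))
    (hadj : ∀ r a b, E r a b → a ≠ b → G.Adj a b) {s : ℕ} (hs : s < 3) {a b : V}
    (hab : E (3 + s) a b) :
    ¬ Relation.EqvGen (fun x y => ∃ r, IsPathRel r ∧ E r x y) a b := by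
  have hph := (hcol _ _ _ hab).phase_sync hs
  have hne : a ≠ b := by rintro rfl; omega
  have hbr := SimpleGraph.isAcyclic_iff_forall_adj_isBridge.1 hG (hadj _ _ _ hab hne)
  rw [SimpleGraph.isBridge_iff] at hbr
  intro h
  refine hbr ?_
  have : ∀ x y, Relation.EqvGen (fun x y => ∃ r, IsPathRel r ∧ E r x y) x y →
      (G \ SimpleGraph.fromEdgeSet {s(a, b)}).Reachable x y := by
    intro x y h
    induction h with
    | rel x y h =>
      obtain ⟨r, hr, h⟩ := h
      have hp := (hcol _ _ _ h).phase_succ hr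
      apply SimpleGraph.Adj.reachable
      rw [SimpleGraph.sdiff_adj, SimpleGraph.fromEdgeSet_adj]
      refine ⟨hadj _ _ _ h (by rintro rfl; omega), ?_⟩
      rintro ⟨h, -⟩
      -- A path edge changes the phase by one, the synchronization edge by two, so deleting the
      -- latter removes no path edge.
      rcases Sym2.eq_iff.1 (Set.mem_singleton_iff.1 h) with ⟨rfl, rfl⟩ | ⟨rfl, rfl⟩ <;> omega
    | refl x => exact SimpleGraph.Reachable.rfl
    | symm x y _ ih => exact ih.symm
    | trans x y z _ _ ih₁ ih₂ => exact ih₁.trans ih₂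
  exact this a b h

theorem eqvGen_of_labelWalk {ρ : List ℕ} (hρ : ∀ r ∈ ρ, IsPathRel r) {a b : V}
    (h : LabelWalk E ρ a b) : Relation.EqvGen (fun x y => ∃ r, IsPathRel r ∧ E r x y) a b := by
  induction ρ generalizing a with
  | nil => cases h; exact .refl _
  | cons r ρ ih =>
    obtain ⟨c, hc, h⟩ := h
    exact .trans _ _ _ (.rel _ _ ⟨r, hρ r (by simp), hc⟩) (ih (fun r hr => hρ r (by simp [hr])) h)

/-- The synchronization facts derived from the facts `E`. -/
inductive Derived (R : List (Rule ℕ)) (E : ℕ → V → V → Prop) : ℕ → V → V → Prop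
  | base {s : ℕ} {x y : V} : s < 3 → E (3 + s) x y → Derived R E s x y
  | init {x y f : V} : E 1 y f → E 2 f x → Derived R E 0 x y
  | step {s s' : ℕ} {u v : List ℕ} {x y x' y' : V} : Derived R E s x y → (s, u, v, s') ∈ R →
      LabelWalk E (wordX u) x x' → LabelWalk E (wordY v) y y' → Derived R E s' x' y'

/-- A derived fact comes from a given synchronization fact, or from the start of a run. -/
theorem Derived.cases_start {R : List (Rule ℕ)} (hR : RulesBounded m R) {s : ℕ} {x y : V}
    (h : Derived R E s x y) :
    (∃ s₀ < 3, ∃ x₀ y₀, E (3 + s₀) x₀ y₀ ∧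
      Relation.EqvGen (fun x y => ∃ r, IsPathRel r ∧ E r x y) x₀ x ∧
      Relation.EqvGen (fun x y => ∃ r, IsPathRel r ∧ E r x y) y₀ y) ∨
    ∃ x₀ y₀ f₀ U V, E 1 y₀ f₀ ∧ E 2 f₀ x₀ ∧ Run R s U V ∧ (∀ i ∈ U, i < m) ∧ (∀ i ∈ V, i < m) ∧
      LabelWalk E (wordX U) x₀ x ∧ LabelWalk E (wordY V) y₀ y := by
  induction h with
  | @base s x y hs h => exact Or.inl ⟨s, hs, x, y, h, .refl _, .refl _⟩
  | @init x y f h₁ h₂ =>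
    exact Or.inr ⟨x, y, f, [], [], h₁, h₂, .nil, by simp, by simp, rfl, rfl⟩
  | step _ hr hX hY ih =>
    obtain ⟨-, -, hu, hv⟩ := hR _ _ _ _ hr
    rcases ih with ⟨s₀, hs₀, x₀, y₀, h₀, h₁, h₂⟩ | ⟨x₀, y₀, f₀, U, V, h₁, h₂, hrun, hU, hV, h₃, h₄⟩
    · exact Or.inl ⟨s₀, hs₀, x₀, y₀, h₀,
        h₁.trans _ _ _ (eqvGen_of_labelWalk (fun r hr => (mem_wordX hu hr).2) hX),
        h₂.trans _ _ _ (eqvGen_of_labelWalk (fun r hr => (mem_wordY hv hr).2) hY)⟩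
    · refine Or.inr ⟨x₀, y₀, f₀, _, _, h₁, h₂, hrun.step hr, ?_, ?_, ?_, ?_⟩
      · simpa [or_imp, forall_and] using ⟨hU, hu⟩
      · simpa [or_imp, forall_and] using ⟨hV, hv⟩
      · rw [wordX_append]; exact h₃.append hX
      · rw [wordY_append]; exact h₄.append hY

/-- In a forest, the heads meet only at the end of a run in which they read the same word. -/
theorem exists_run_of_derived (hG : G.IsAcyclic)
    (hcol : ∀ r a b, E r a b → CycleRel m r (col a) (col b))
    (hadj : ∀ r a b, E r a b → a ≠ b → G.Adj a b) {R : List (Rule ℕ)} (hR : RulesBounded m R)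
    {s : ℕ} {x y f : V} (h : Derived R E s x y) (h₁ : E 1 y f) (h₂ : E 2 f x) :
    ∃ U, Run R s U U := by
  have h12 : LabelWalk E [1, 2] y x := ⟨f, h₁, x, h₂, rfl⟩
  have hr12 : ∀ r ∈ [1, 2], IsPathRel r := by
    intro r hr
    simp only [List.mem_cons, List.not_mem_nil, or_false] at hr
    unfold IsPathRel
    omega
  rcases h.cases_start hR with ⟨s₀, hs₀, x₀, y₀, h₀, hx, hy⟩ |
    ⟨x₀, y₀, f₀, U, W, h₃, h₄, hrun, hU, hW, hX, hY⟩
  -- Heads started from a given synchronization fact would connect its two ends by path edges where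
  -- they meet.
  · exact absurd (hx.trans _ _ _ ((eqvGen_of_labelWalk hr12 h12).symm.trans _ _ _ hy.symm))
      (not_reachable_of_sync hG hcol hadj hs₀ h₀)
  -- Two walks from `y₀` to `x`: edges 1, 2 at the start and then the first head, or the second head
  -- and then edges 1, 2 at the meeting place.
  · have hw₁ : LabelWalk E ([1, 2] ++ wordX U) y₀ x := by
      refine LabelWalk.append (b := x₀) ⟨f₀, h₃, x₀, h₄, rfl⟩ hX
    have hw₂ : LabelWalk E ([1, 2] ++ wordX W) y₀ x := by
      rw [← wordY_shift]
      exact hY.append h12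
    have := labelWalk_unique hG hcol hadj
      (fun r hr => (List.mem_append.1 hr).elim (hr12 r) fun hr => (mem_wordX hU hr).2)
      (fun r hr => (List.mem_append.1 hr).elim (hr12 r) fun hr => (mem_wordX hW hr).2) hw₁ hw₂
    obtain rfl := wordX_injective (List.append_cancel_left this)
    exact ⟨U, hrun⟩

end Forest

/-! ### The derived model of an acyclic query -/

/-- The facts together with the derived synchronization facts. -/
def derivedModel (R : List (Rule ℕ)) (I : Instance) : Instance :=
  {F | F ∈ I ∨ ∃ s < 3, ∃ x y,
    Derived R (fun r a b => ((r, [Sum.inr a, Sum.inr b]) : Fact) ∈ I) s x y ∧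
      F = (3 + s, [Sum.inr x, Sum.inr y])}

theorem mem_derivedModel_of_isPathRel {R : List (Rule ℕ)} {I : Instance} {r : ℕ} {l : List Value}
    (hr : IsPathRel r) (h : ((r, l) : Fact) ∈ derivedModel R I) : ((r, l) : Fact) ∈ I := by
  rcases h with h | ⟨s, hs, x, y, -, e⟩
  · exact h
  · have := congrArg Prod.fst e
    simp only at this
    unfold IsPathRel at hr
    omega

theorem derived_of_mem_derivedModel {R : List (Rule ℕ)} {I : Instance} {s : ℕ} {a b : Null}
    (hs : s < 3) (h : ((3 + s, [Sum.inr a, Sum.inr b]) : Fact) ∈ derivedModel R I) :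
    Derived R (fun r a b => ((r, [Sum.inr a, Sum.inr b]) : Fact) ∈ I) s a b := by
  rcases h with h | ⟨s', hs', x, y, hd, e⟩
  · exact .base hs h
  · simp only [Prod.mk.injEq, List.cons.injEq, Sum.inr.injEq, and_true] at e
    obtain ⟨e, rfl, rfl⟩ := e
    obtain rfl : s = s' := by omega
    exact hd

theorem labelWalk_derivedModel {R : List (Rule ℕ)} {I : Instance}
    (hI : ∀ F ∈ I, ∃ r a b, F = ((r, [Sum.inr a, Sum.inr b]) : Fact)) {ρ : List ℕ}
    (hρ : ∀ r ∈ ρ, IsPathRel r) {x y : Value} {a : Null}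
    (h : LabelWalk (fun r x y => ((r, [x, y]) : Fact) ∈ derivedModel R I) ρ x y)
    (hx : x = Sum.inr a) :
    ∃ b, y = Sum.inr b ∧
      LabelWalk (fun r a b => ((r, [Sum.inr a, Sum.inr b]) : Fact) ∈ I) ρ a b := by
  induction ρ generalizing x a with
  | nil => exact ⟨a, h ▸ hx, rfl⟩
  | cons r ρ ih =>
    obtain ⟨c, hc, h⟩ := h
    have hc := mem_derivedModel_of_isPathRel (hρ r (by simp)) hc
    obtain ⟨r', a', c', e⟩ := hI _ hc
    simp only [Prod.mk.injEq, List.cons.injEq, and_true] at e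
    obtain ⟨rfl, rfl, rfl⟩ := e
    obtain ⟨b, hb, hw⟩ := ih (fun r hr => hρ r (by simp [hr])) h rfl
    cases hx
    exact ⟨b, hb, c', hc, hw⟩

/-- `Derived` is closed under the starting and moving tgds by construction; `hgoal` says that the
body of `goalTGD` is never matched. -/
theorem models_derivedModel {m : ℕ} {R : List (Rule ℕ)} (hR : RulesBounded m R) {I : Instance}
    (hI : ∀ F ∈ I, ∃ r a b, F = ((r, [Sum.inr a, Sum.inr b]) : Fact))
    (hgoal : ∀ x y f : Null, Derived R (fun r a b => ((r, [Sum.inr a, Sum.inr b]) : Fact) ∈ I) 2 x y →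
      ((1, [Sum.inr y, Sum.inr f]) : Fact) ∈ I → ((2, [Sum.inr f, Sum.inr x]) : Fact) ∈ I → False) :
    Models (derivedModel R I) (ruleTGDs m R) := by
  have h2 : ∀ {r : ℕ} {x y : Value}, ((r, [x, y]) : Fact) ∈ derivedModel R I →
      ∃ a b, x = Sum.inr a ∧ y = Sum.inr b := by
    intro r x y h
    have : ∃ r' a b, ((r, [x, y]) : Fact) = ((r', [Sum.inr a, Sum.inr b]) : Fact) := by
      rcases h with h | ⟨s, -, a, b, -, e⟩
      · exact hI _ h
      · exact ⟨_, a, b, e⟩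
    obtain ⟨r', a, b, e⟩ := this
    simp only [Prod.mk.injEq, List.cons.injEq, and_true] at e
    exact ⟨a, b, e.2⟩
  intro τ hτ
  refine TGD.holds_of_isHom_head fun h hb => ?_
  simp only [ruleTGDs, List.mem_cons, List.mem_map] at hτ
  rcases hτ with rfl | rfl | ⟨⟨s, u, v, s'⟩, hr, rfl⟩
  · have h₁ : ((1, [h 1, h 2]) : Fact) ∈ derivedModel R I :=
      hb (bin 1 1 2) (by simp [initTGD, TGD.body])
    have h₂ : ((2, [h 2, h 0]) : Fact) ∈ derivedModel R I :=
      hb (bin 2 2 0) (by simp [initTGD, TGD.body])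
    replace h₁ := mem_derivedModel_of_isPathRel (Or.inl (by omega)) h₁
    replace h₂ := mem_derivedModel_of_isPathRel (Or.inl (by omega)) h₂
    obtain ⟨b, c, e₁, e₂⟩ := h2 (Or.inl h₁)
    obtain ⟨-, a, -, e₃⟩ := h2 (Or.inl h₂)
    intro A hA
    simp only [initTGD, TGD.head, List.mem_cons, List.not_mem_nil, or_false] at hA
    subst hA
    refine Or.inr ⟨0, by omega, a, b, .init (f := c) ?_ ?_, ?_⟩
    · show ((1, [Sum.inr b, Sum.inr c]) : Fact) ∈ I
      rwa [← e₁, ← e₂]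
    · show ((2, [Sum.inr c, Sum.inr a]) : Fact) ∈ I
      rwa [← e₂, ← e₃]
    · show ((3, [h 0, h 1]) : Fact) = _
      rw [e₁, e₃]
  · exfalso
    have h₀ : ((3 + 2, [h 0, h 1]) : Fact) ∈ derivedModel R I :=
      hb (bin 5 0 1) (by simp [goalTGD, TGD.body])
    have h₁ : ((1, [h 1, h 2]) : Fact) ∈ derivedModel R I :=
      hb (bin 1 1 2) (by simp [goalTGD, TGD.body])
    have h₂ : ((2, [h 2, h 0]) : Fact) ∈ derivedModel R I :=
      hb (bin 2 2 0) (by simp [goalTGD, TGD.body])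
    replace h₁ := mem_derivedModel_of_isPathRel (Or.inl (by omega)) h₁
    replace h₂ := mem_derivedModel_of_isPathRel (Or.inl (by omega)) h₂
    obtain ⟨b, c, e₁, e₂⟩ := h2 (Or.inl h₁)
    obtain ⟨-, a, -, e₃⟩ := h2 (Or.inl h₂)
    rw [e₁, e₃] at h₀
    rw [e₁, e₂] at h₁
    rw [e₂, e₃] at h₂
    exact hgoal a b c (derived_of_mem_derivedModel (by omega) h₀) h₁ h₂
  · obtain ⟨hs, hX, hY⟩ := isHom_ruleTGD_body hb
    obtain ⟨hs₁, hs₂, hu, hv⟩ := hR _ _ _ _ hr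
    obtain ⟨a, b, e₁, e₂⟩ := h2 hs
    obtain ⟨c, e₃, hX⟩ := labelWalk_derivedModel hI (fun r hr => (mem_wordX hu hr).2) hX e₁
    obtain ⟨d, e₄, hY⟩ := labelWalk_derivedModel hI (fun r hr => (mem_wordY hv hr).2) hY e₂
    intro A hA
    simp only [ruleTGD, TGD.head, List.mem_cons, List.not_mem_nil, or_false] at hA
    subst hA
    rw [e₁, e₂] at hs
    refine Or.inr ⟨s', hs₂, c, d, .step (derived_of_mem_derivedModel hs₁ hs) hr hX hY, ?_⟩
    show ((3 + s', [h (4 * u.length), h (4 * u.length + 1 + 4 * v.length)]) : Fact) = _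
    rw [e₃, e₄]

theorem run_of_semanticallyAcyclic {m : ℕ} (hm : 0 < m) {R : List (Rule ℕ)} (hR : RulesBounded m R)
    (h : SemanticallyAcyclic (wordSchema m) (ruleTGDs m R) (cycleQuery m)) :
    ∃ U, Run R 2 U U := by
  obtain ⟨q, hq, hqa, hle, hge⟩ := h
  -- The cyclic query holds in its model, hence so does `q`; the match `g` is the colouring.
  obtain ⟨g, hg, -⟩ := hle _ (cycleModel_isOver m) (models_cycleModel hR) (a := [])
    ⟨Sum.inr, isHom_cycleModel m, rfl⟩
  -- the canonical instance of the acyclic query maps to the model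
  have hI : ∀ F ∈ q.canonicalInstance, ∃ r a b, F = ((r, [Sum.inr a, Sum.inr b]) : Fact) ∧
      ∃ a' b', g a = Sum.inr a' ∧ g b = Sum.inr b' ∧ CycleRel m r a' b' := by
    rintro F ⟨A, hA, rfl⟩
    rw [Atom.apply_inr]
    obtain ⟨r, a', b', hr, e⟩ := hg A hA
    obtain ⟨r', l⟩ := A
    simp only [Atom.apply, Prod.mk.injEq] at e
    obtain ⟨rfl, e⟩ := e
    rcases l with _ | ⟨t₁, _ | ⟨t₂, _ | ⟨t₃, l⟩⟩⟩ <;> simp at e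
    rcases t₁ with c | a <;> rcases t₂ with d | b <;> simp [applyTerm] at e
    exact ⟨r', a, b, rfl, a', b', e.1, e.2, hr⟩
  have hI' : ∀ F ∈ q.canonicalInstance, ∃ r a b, F = ((r, [Sum.inr a, Sum.inr b]) : Fact) :=
    fun F hF => by obtain ⟨r, a, b, e, -⟩ := hI F hF; exact ⟨r, a, b, e⟩
  let E : ℕ → Null → Null → Prop :=
    fun r a b => ((r, [Sum.inr a, Sum.inr b]) : Fact) ∈ q.canonicalInstance
  let col : Null → ℕ := fun a => Sum.elim id id (g a)
  have hcol : ∀ r a b, E r a b → CycleRel m r (col a) (col b) := by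
    intro r a b hE
    obtain ⟨r', a₁, b₁, e, a', b', e₁, e₂, hr⟩ := hI _ hE
    simp only [Prod.mk.injEq, List.cons.injEq, Sum.inr.injEq, and_true] at e
    obtain ⟨rfl, rfl, rfl⟩ := e
    simpa [col, e₁, e₂] using hr
  have hG : (gaifman q.canonicalInstance).IsAcyclic := by
    refine gaifman_isAcyclic hqa fun F hF a b x hne ha hb hx => ?_
    obtain ⟨r, a', b', rfl⟩ := hI' F hF
    simp only [List.mem_cons, Sum.inr.injEq, List.not_mem_nil, or_false] at ha hb hx
    grind
  have hadj : ∀ r a b, E r a b → a ≠ b → (gaifman q.canonicalInstance).Adj a b :=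
    fun r a b hE hne => ⟨hne, _, hE, by simp, by simp⟩
  by_contra hno
  have hM := models_derivedModel (m := m) hR hI' fun x y f hd h₁ h₂ =>
    hno (exists_run_of_derived hG hcol hadj hR hd h₁ h₂)
  have hover : (derivedModel R q.canonicalInstance).IsOver (wordSchema m) := by
    rintro F (⟨A, hA, rfl⟩ | ⟨s, hs, x, y, -, rfl⟩)
    · exact atom_apply_isOver (hq.1.2 A hA) _
    · exact hasRel_wordSchema.2 ⟨by simp only; omega, rfl⟩
  obtain ⟨k, hk, -⟩ := hge _ hover hM
    ⟨Sum.inr, fun A hA => Or.inl (isHom_canonicalInstance q A hA), rfl⟩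
  obtain ⟨h₁, h₂, h₃⟩ := isHom_cycleAtoms.1 hk
  -- One letter suffices: its 4-cycle is a closed labelled walk among the atoms of `q`, while by
  -- uniqueness only the empty word labels a closed walk.
  obtain ⟨h₃, h₄⟩ := h₃ 0 hm
  replace h₁ := mem_derivedModel_of_isPathRel (Or.inl (by omega)) h₁
  obtain ⟨_, b, _, e⟩ := hI' _ h₁
  simp only [Prod.mk.injEq, List.cons.injEq, and_true] at e
  have hρ : ∀ r ∈ [1, 2, 6 + 0, 0], IsPathRel r := by
    intro r hr
    simp only [List.mem_cons, List.not_mem_nil, or_false] at hr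
    unfold IsPathRel
    omega
  obtain ⟨c, e', hw⟩ := labelWalk_derivedModel hI' hρ (x := k 1) (y := k 1)
    ⟨k 2, Or.inl h₁, k 0, h₂, _, h₃, _, h₄, rfl⟩ e.2.1
  have hbc : b = c := Sum.inr_injective (e.2.1.symm.trans e')
  rw [← hbc] at hw
  have := labelWalk_unique hG hcol hadj hρ (ρ' := []) (by simp) hw rfl
  simp at this

theorem semanticallyAcyclic_iff_run {m : ℕ} (hm : 0 < m) {R : List (Rule ℕ)}
    (hR : RulesBounded m R) :
    SemanticallyAcyclic (wordSchema m) (ruleTGDs m R) (cycleQuery m) ↔ ∃ U, Run R 2 U U :=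
  ⟨run_of_semanticallyAcyclic hm hR, fun ⟨_, h⟩ => semanticallyAcyclic_of_run hR h⟩

end SemAc

/-! ### Halting of Turing machines as two-head runs -/

namespace SemAc

open Turing

/-! ### Turing machines as rewriting systems on circular words -/

section TM0

/-- The letters of the words that describe configurations: a separator, tape symbols, and tape
symbols under the head, annotated with the state. -/
inductive Letter (Γ Λ : Type) where
  | sep : Letter Γ Λ
  | sym : Γ → Letter Γ Λ
  | head : Λ → Γ → Letter Γ Λ

open Letter

/-- An enumeration of the letters. -/
noncomputable def allLetters (Γ Λ : Type) [Fintype Γ] [Fintype Λ] : List (Letter Γ Λ) :=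
  sep :: ((Finset.univ : Finset Γ).toList.map sym ++
    (Finset.univ : Finset (Λ × Γ)).toList.map fun p => head p.1 p.2)

theorem mem_allLetters {Γ Λ : Type} [Fintype Γ] [Fintype Λ] (c : Letter Γ Λ) : c ∈ allLetters Γ Λ := by
  cases c <;> simp [allLetters]

variable {Γ Λ : Type} [Inhabited Γ] [Inhabited Λ]

/-- The rules that simulate the transition at a given state and symbol. -/
noncomputable def transitionRules [Fintype Γ] (q : Λ) (a : Γ) :
    Option (Λ × TM0.Stmt Γ) → List (Rule (Letter Γ Λ))
  | none => [(1, [head q a], [], 2)]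
  | some (q', TM0.Stmt.write b) => [(1, [head q a], [head q' b], 1)]
  | some (q', TM0.Stmt.move Dir.right) => (Finset.univ : Finset Γ).toList.map fun c =>
      (1, [head q a, sym c], [sym a, head q' c], 1)
  | some (q', TM0.Stmt.move Dir.left) => (Finset.univ : Finset Γ).toList.map fun c =>
      (1, [sym c, head q a], [head q' c, sym a], 1)

/-- The rules that do not depend on the input. -/
noncomputable def machineRules [Fintype Γ] [Fintype Λ] (M : TM0.Machine Γ Λ) :
    List (Rule (Letter Γ Λ)) :=
  (1, [sep], [sym default, sep, sym default], 1) ::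
    ((allLetters Γ Λ).map (fun c => (1, [c], [c], 1)) ++
    (allLetters Γ Λ).map (fun c => (2, [c], [], 2)) ++
    (Finset.univ : Finset (Λ × Γ)).toList.flatMap fun p => transitionRules p.1 p.2 (M p.1 p.2))

/-- The rule that starts the simulation with a given word. -/
def startRule {α : Type} (w : List α) : Rule α := (0, [], w, 1)

/-- The possible forms of a rule in state `1`. -/
inductive WorkRule (M : TM0.Machine Γ Λ) :
    List (Letter Γ Λ) → List (Letter Γ Λ) → ℕ → Prop
  | pad : WorkRule M [sep] [sym default, sep, sym default] 1
  | copy (c : Letter Γ Λ) : WorkRule M [c] [c] 1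
  | halt (q : Λ) (a : Γ) (h : M q a = none) : WorkRule M [head q a] [] 2
  | write (q : Λ) (a : Γ) (q' : Λ) (b : Γ) (h : M q a = some (q', TM0.Stmt.write b)) :
      WorkRule M [head q a] [head q' b] 1
  | right (q : Λ) (a : Γ) (q' : Λ) (c : Γ) (h : M q a = some (q', TM0.Stmt.move Dir.right)) :
      WorkRule M [head q a, sym c] [sym a, head q' c] 1
  | left (q : Λ) (a : Γ) (q' : Λ) (c : Γ) (h : M q a = some (q', TM0.Stmt.move Dir.left)) :
      WorkRule M [sym c, head q a] [head q' c, sym a] 1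

theorem mem_transitionRules [Fintype Γ] {M : TM0.Machine Γ Λ} {q : Λ} {a : Γ} {s s' : ℕ}
    {u v : List (Letter Γ Λ)} (h : (s, u, v, s') ∈ transitionRules q a (M q a)) :
    s = 1 ∧ WorkRule M u v s' := by
  rcases hM : M q a with _ | ⟨q', d | b⟩
  · rw [hM] at h
    simp only [transitionRules, List.mem_singleton, Prod.mk.injEq] at h
    obtain ⟨rfl, rfl, rfl, rfl⟩ := h
    exact ⟨rfl, .halt q a hM⟩
  · rw [hM] at h
    cases d <;> simp only [transitionRules, List.mem_map, Finset.mem_toList, Finset.mem_univ,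
      true_and, Prod.mk.injEq] at h <;> obtain ⟨c, rfl, rfl, rfl, rfl⟩ := h
    · exact ⟨rfl, .left q a q' c hM⟩
    · exact ⟨rfl, .right q a q' c hM⟩
  · rw [hM] at h
    simp only [transitionRules, List.mem_singleton, Prod.mk.injEq] at h
    obtain ⟨rfl, rfl, rfl, rfl⟩ := h
    exact ⟨rfl, .write q a q' b hM⟩

theorem mem_machineRules [Fintype Γ] [Fintype Λ] {M : TM0.Machine Γ Λ} {s s' : ℕ}
    {u v : List (Letter Γ Λ)} (h : (s, u, v, s') ∈ machineRules M) :
    (s = 1 ∧ WorkRule M u v s') ∨ s = 2 ∧ s' = 2 := by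
  simp only [machineRules, List.mem_cons, List.mem_append, List.mem_map, List.mem_flatMap,
    Prod.mk.injEq] at h
  rcases h with ⟨rfl, rfl, rfl, rfl⟩ | (⟨c, -, rfl, rfl, rfl, rfl⟩ | ⟨c, -, rfl, rfl, rfl, rfl⟩) |
    ⟨p, -, h⟩
  · exact Or.inl ⟨rfl, .pad⟩
  · exact Or.inl ⟨rfl, .copy c⟩
  · exact Or.inr ⟨rfl, rfl⟩
  · exact Or.inl (mem_transitionRules h)

theorem workRule_mem [Fintype Γ] [Fintype Λ] {M : TM0.Machine Γ Λ} {s' : ℕ}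
    {u v : List (Letter Γ Λ)} (h : WorkRule M u v s') : (1, u, v, s') ∈ machineRules M := by
  have key : ∀ q a, (1, u, v, s') ∈ transitionRules q a (M q a) →
      (1, u, v, s') ∈ machineRules M := fun q a h => by
    refine List.mem_cons_of_mem _ (List.mem_append_right _ (List.mem_flatMap.2 ⟨(q, a), ?_, h⟩))
    simp
  cases h with
  | pad => exact List.mem_cons_self
  | copy c =>
    exact List.mem_cons_of_mem _ (List.mem_append_left _ (List.mem_append_left _
      (List.mem_map.2 ⟨c, mem_allLetters c, rfl⟩)))
  | halt q a h => exact key q a (by rw [h]; simp [transitionRules])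
  | write q a q' b h => exact key q a (by rw [h]; simp [transitionRules])
  | right q a q' c h => exact key q a (by rw [h]; simp [transitionRules])
  | left q a q' c h => exact key q a (by rw [h]; simp [transitionRules])

theorem delete_mem [Fintype Γ] [Fintype Λ] (M : TM0.Machine Γ Λ) (c : Letter Γ Λ) :
    (2, [c], [], 2) ∈ machineRules M :=
  List.mem_cons_of_mem _ (List.mem_append_left _ (List.mem_append_right _
    (List.mem_map.2 ⟨c, mem_allLetters c, rfl⟩)))

/-! #### Words that describe configurations -/

/-- The configuration with tape contents `l` to the left of the head, `a` under the head and `r`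
to its right. -/
def mkCfg (l : List Γ) (q : Λ) (a : Γ) (r : List Γ) : TM0.Cfg Γ Λ :=
  ⟨q, Tape.mk' (ListBlank.mk l.reverse) (ListBlank.mk (a :: r))⟩

/-- The word that describes this configuration. -/
def cfgWord (l : List Γ) (q : Λ) (a : Γ) (r : List Γ) : List (Letter Γ Λ) :=
  l.map sym ++ head q a :: r.map sym

/-- The word describes the configuration. -/
def Describes (S : List (Letter Γ Λ)) (c : TM0.Cfg Γ Λ) : Prop :=
  ∃ l q a r, S = cfgWord l q a r ∧ c = mkCfg l q a r

theorem listBlank_mk_append_default (l : List Γ) :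
    ListBlank.mk (l ++ [default]) = ListBlank.mk l :=
  (Quotient.sound' (Or.inl ⟨1, rfl⟩)).symm

theorem mkCfg_pad (l : List Γ) (q : Λ) (a : Γ) (r : List Γ) :
    mkCfg (default :: l) q a (r ++ [default]) = mkCfg l q a r := by
  unfold mkCfg
  rw [List.reverse_cons, listBlank_mk_append_default, ← List.cons_append,
    listBlank_mk_append_default]

theorem step_mkCfg_none {M : TM0.Machine Γ Λ} {q : Λ} {a : Γ} (h : M q a = none) (l r : List Γ) :
    TM0.step M (mkCfg l q a r) = none := by
  show Option.map _ (M q a) = none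
  rw [h]
  rfl

theorem step_mkCfg_write {M : TM0.Machine Γ Λ} {q q' : Λ} {a b : Γ}
    (h : M q a = some (q', TM0.Stmt.write b)) (l r : List Γ) :
    TM0.step M (mkCfg l q a r) = some (mkCfg l q' b r) := by
  show Option.map _ (M q a) = _
  rw [h]
  rfl

theorem step_mkCfg_right {M : TM0.Machine Γ Λ} {q q' : Λ} {a : Γ}
    (h : M q a = some (q', TM0.Stmt.move Dir.right)) (l : List Γ) (c : Γ) (r : List Γ) :
    TM0.step M (mkCfg l q a (c :: r)) = some (mkCfg (l ++ [a]) q' c r) := by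
  show Option.map _ (M q a) = _
  rw [h]
  simp only [Option.map_some, Option.some.injEq, mkCfg]
  rw [Tape.move_right_mk', ListBlank.head_mk, ListBlank.cons_mk, ListBlank.tail_mk]
  simp

theorem step_mkCfg_left {M : TM0.Machine Γ Λ} {q q' : Λ} {a : Γ}
    (h : M q a = some (q', TM0.Stmt.move Dir.left)) (l : List Γ) (c : Γ) (r : List Γ) :
    TM0.step M (mkCfg (l ++ [c]) q a r) = some (mkCfg l q' c (a :: r)) := by
  show Option.map _ (M q a) = _
  rw [h]
  simp only [Option.map_some, Option.some.injEq, mkCfg]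
  rw [Tape.move_left_mk', ListBlank.head_mk, ListBlank.cons_mk, ListBlank.tail_mk]
  simp

/-! #### From halting computations to runs -/

section Completeness

variable [Fintype Γ] [Fintype Λ] {M : TM0.Machine Γ Λ} {R : List (Rule (Letter Γ Λ))}

/-- Some run leaves the word `X` between the two heads. -/
def Pending (R : List (Rule (Letter Γ Λ))) (X : List (Letter Γ Λ)) : Prop :=
  ∃ U, Run R 1 U (U ++ X)

/-- The word between the heads is a queue: `u` leaves at the front and `v` enters at the back. -/
theorem Pending.rule {u v Y : List (Letter Γ Λ)} (hr : (1, u, v, 1) ∈ R)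
    (h : Pending R (u ++ Y)) : Pending R (Y ++ v) := by
  obtain ⟨U, h⟩ := h
  refine ⟨U ++ u, ?_⟩
  have := h.step hr
  simpa using this

theorem Pending.rotate (hR : machineRules M ⊆ R) {X Y : List (Letter Γ Λ)}
    (h : Pending R (X ++ Y)) : Pending R (Y ++ X) := by
  induction X generalizing Y with
  | nil => simpa using h
  | cons c X ih =>
    have := ih (Y := Y ++ [c]) (by
      have := Pending.rule (u := [c]) (Y := X ++ Y) (hR (workRule_mem (M := M) (.copy c))) h
      simpa using this)
    simpa using this

/-- Copy rules rotate `u` to the front, the rule replaces it, and further copying restores the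
order. -/
theorem Pending.replace (hR : machineRules M ⊆ R) {u v X Y : List (Letter Γ Λ)}
    (hr : (1, u, v, 1) ∈ R) (h : Pending R (X ++ u ++ Y)) : Pending R (X ++ v ++ Y) := by
  have h₁ : Pending R (u ++ (Y ++ X)) := by
    rw [List.append_assoc] at h
    have := Pending.rotate hR h
    simpa using this
  have h₂ := Pending.rule hr h₁
  rw [List.append_assoc] at h₂
  exact Pending.rotate hR h₂

/-- A blank placed after the separator is, up to rotation, a blank at the left end of the tape. -/
theorem Pending.pad (hR : machineRules M ⊆ R) {l r : List Γ} {q : Λ} {a : Γ}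
    (h : Pending R (cfgWord l q a r ++ [sep])) :
    Pending R (cfgWord (default :: l) q a (r ++ [default]) ++ [sep]) := by
  have h₁ := Pending.replace hR (X := cfgWord l q a r) (Y := []) (hR (workRule_mem (M := M) .pad))
    (by simpa using h)
  have h₂ := Pending.rotate hR (X := cfgWord l q a r ++ [sym default, sep]) (Y := [sym default])
    (by simpa using h₁)
  simpa [cfgWord] using h₂

/-- Some word that describes the configuration is left between the two heads by some run. -/
def PendingCfg (R : List (Rule (Letter Γ Λ))) (c : TM0.Cfg Γ Λ) : Prop :=
  ∃ l q a r, c = mkCfg l q a r ∧ Pending R (cfgWord l q a r ++ [sep])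

theorem PendingCfg.step (hR : machineRules M ⊆ R) {c c' : TM0.Cfg Γ Λ} (h : PendingCfg R c)
    (hc : c' ∈ TM0.step M c) : PendingCfg R c' := by
  obtain ⟨l, q, a, r, rfl, h⟩ := h
  rcases hM : M q a with _ | ⟨q', d | b⟩
  · rw [step_mkCfg_none hM] at hc
    cases hc
  · rw [← mkCfg_pad] at hc
    have h := Pending.pad hR h
    cases d with
    | left =>
      obtain ⟨l', x, hl⟩ : ∃ l' x, default :: l = l' ++ [x] :=
        ⟨_, _, (List.dropLast_append_getLast (List.cons_ne_nil default l)).symm⟩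
      rw [hl] at h hc
      rw [step_mkCfg_left hM] at hc
      obtain rfl := Option.some.inj hc
      refine ⟨l', q', x, a :: (r ++ [default]), rfl, ?_⟩
      have := Pending.replace hR (X := l'.map sym) (Y := (r ++ [default]).map sym ++ [sep])
        (hR (workRule_mem (M := M) (.left q a q' x hM))) (by simpa [cfgWord] using h)
      simpa [cfgWord] using this
    | right =>
      obtain ⟨x, r', hr⟩ : ∃ x r', r ++ [default] = x :: r' := by
        cases r <;> simp
      rw [hr] at h hc
      rw [step_mkCfg_right hM] at hc
      obtain rfl := Option.some.inj hc
      refine ⟨(default :: l) ++ [a], q', x, r', rfl, ?_⟩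
      have := Pending.replace hR (X := (default :: l).map sym) (Y := r'.map sym ++ [sep])
        (hR (workRule_mem (M := M) (.right q a q' x hM))) (by simpa [cfgWord] using h)
      simpa [cfgWord] using this
  · rw [step_mkCfg_write hM] at hc
    obtain rfl := Option.some.inj hc
    refine ⟨l, q', b, r, rfl, ?_⟩
    have := Pending.replace hR (X := l.map sym) (Y := r.map sym ++ [sep])
      (hR (workRule_mem (M := M) (.write q a q' b hM))) (by simpa [cfgWord] using h)
    simpa [cfgWord] using this

theorem PendingCfg.reaches (hR : machineRules M ⊆ R) {c c' : TM0.Cfg Γ Λ} (h : PendingCfg R c)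
    (hc : TM0.Reaches M c c') : PendingCfg R c' := by
  induction hc with
  | refl => exact h
  | tail _ hst ih => exact ih.step hR hst

/-- In state 2 the second head stands still while the first reads what is left. -/
theorem run_consume (hR : machineRules M ⊆ R) {U X : List (Letter Γ Λ)}
    (h : Run R 2 U (U ++ X)) : Run R 2 (U ++ X) (U ++ X) := by
  induction X generalizing U with
  | nil => simpa using h
  | cons c X ih =>
    have := h.step (hR (delete_mem M c))
    have := ih (U := U ++ [c]) (by simpa using this)
    simpa using this

theorem PendingCfg.exists_run (hR : machineRules M ⊆ R) {c : TM0.Cfg Γ Λ} (h : PendingCfg R c)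
    (hc : TM0.step M c = none) : ∃ U, Run R 2 U U := by
  obtain ⟨l, q, a, r, rfl, h⟩ := h
  have hM : M q a = none := Option.map_eq_none_iff.1 hc
  obtain ⟨U, h⟩ := Pending.rotate hR (X := l.map sym) (Y := head q a :: (r.map sym ++ [sep]))
    (by simpa [cfgWord] using h)
  have := h.step (hR (workRule_mem (.halt q a hM)))
  exact ⟨_, run_consume hR (U := U ++ [head q a]) (X := r.map sym ++ [sep] ++ l.map sym)
    (by simpa using this)⟩

end Completeness

/-! #### From runs to halting computations -/

section Soundness

variable {M : TM0.Machine Γ Λ}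

theorem sep_notMem_cfgWord (l : List Γ) (q : Λ) (a : Γ) (r : List Γ) :
    sep ∉ cfgWord l q a r := by
  simp [cfgWord]

/-- A configuration word has exactly one head letter, so the place of a transition is forced. -/
theorem cfgWord_split {P Q : List (Letter Γ Λ)} {q q' : Λ} {a a' : Γ} {l r : List Γ}
    (h : P ++ head q a :: Q = cfgWord l q' a' r) :
    P = l.map sym ∧ q = q' ∧ a = a' ∧ Q = r.map sym := by
  induction P generalizing l with
  | nil =>
    cases l with
    | nil => simpa [cfgWord, and_assoc] using h
    | cons x l => simp [cfgWord] at h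
  | cons c P ih =>
    cases l with
    | nil =>
      simp only [cfgWord, List.map_nil, List.nil_append, List.cons_append, List.cons.injEq] at h
      have : head q a ∈ r.map (sym : Γ → Letter Γ Λ) := by rw [← h.2]; simp
      simp at this
    | cons x l =>
      simp only [cfgWord, List.map_cons, List.cons_append, List.cons.injEq] at h
      obtain ⟨h₁, h₂, h₃, h₄⟩ := ih h.2
      exact ⟨by simp [h.1, h₁], h₂, h₃, h₄⟩

/-- Up to rotation, the word describes a configuration reachable from `c₀`. -/
def Circular (M : TM0.Machine Γ Λ) (c₀ : TM0.Cfg Γ Λ) (X : List (Letter Γ Λ)) : Prop :=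
  ∃ A B c, X = A ++ sep :: B ∧ Describes (B ++ A) c ∧ TM0.Reaches M c₀ c

/-- Rules in state 1 read at most two letters, so the first head never overtakes the second. -/
theorem Circular.two_le_length {c₀ : TM0.Cfg Γ Λ} {X : List (Letter Γ Λ)}
    (h : Circular M c₀ X) : 2 ≤ X.length := by
  obtain ⟨A, B, c, rfl, ⟨l, q, a, r, h, -⟩, -⟩ := h
  have := congrArg List.length h
  simp only [cfgWord, List.length_append, List.length_cons] at *
  omega

theorem describes_copy {A B : List (Letter Γ Λ)} {c : TM0.Cfg Γ Λ} (x : Letter Γ Λ)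
    {Y : List (Letter Γ Λ)} (hX : x :: Y = A ++ sep :: B) (h : Describes (B ++ A) c) :
    ∃ A' B', Y ++ [x] = A' ++ sep :: B' ∧ Describes (B' ++ A') c := by
  cases A with
  | nil =>
    simp only [List.nil_append, List.cons.injEq] at hX
    obtain ⟨rfl, rfl⟩ := hX
    exact ⟨Y, [], rfl, by simpa using h⟩
  | cons y A =>
    simp only [List.cons_append, List.cons.injEq] at hX
    obtain ⟨rfl, rfl⟩ := hX
    exact ⟨A, B ++ [x], by simp, by simpa using h⟩

/-- A prefix without separators of a circular word lies before the separator. -/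
theorem exists_of_prefix {u A B Y : List (Letter Γ Λ)} (hu : sep ∉ u)
    (h : u ++ Y = A ++ sep :: B) : ∃ A', A = u ++ A' ∧ Y = A' ++ sep :: B := by
  induction u generalizing A with
  | nil => exact ⟨A, rfl, h⟩
  | cons x u ih =>
    cases A with
    | nil =>
      simp only [List.cons_append, List.nil_append, List.cons.injEq] at h
      exact absurd h.1 (by rintro rfl; simp at hu)
    | cons y A =>
      simp only [List.cons_append, List.cons.injEq] at h
      obtain ⟨rfl, h⟩ := h
      obtain ⟨A', rfl, rfl⟩ := ih (fun hx => hu (by simp [hx])) h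
      exact ⟨A', rfl, rfl⟩

/-- Copying only rotates, padding only adds blanks, and every other rule must fire at the unique
head letter, where it performs one machine step. -/
theorem Circular.work {c₀ : TM0.Cfg Γ Λ} {u v Y : List (Letter Γ Λ)}
    (h : Circular M c₀ (u ++ Y)) (hr : WorkRule M u v 1) : Circular M c₀ (Y ++ v) := by
  obtain ⟨A, B, c, hX, hd, hc⟩ := h
  have key : ∀ {u v : List (Letter Γ Λ)}, sep ∉ u → u ++ Y = A ++ sep :: B →
      (∀ P Q, Describes (P ++ u ++ Q) c → ∃ c', Describes (P ++ v ++ Q) c' ∧ c' ∈ TM0.step M c) →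
      Circular M c₀ (Y ++ v) := by
    intro u v hu hX H
    obtain ⟨A', rfl, rfl⟩ := exists_of_prefix hu hX
    obtain ⟨c', hd', hs⟩ := H B A' (by simpa using hd)
    exact ⟨A', B ++ v, c', by simp, by simpa using hd', hc.tail hs⟩
  cases hr with
  | pad =>
    obtain ⟨l, q, a, r, hl, rfl⟩ := hd
    -- The separator occurs only once, so the one being read is the marked one.
    have hA : A = [] := by
      cases A with
      | nil => rfl
      | cons y A =>
        simp only [List.cons_append, List.nil_append, List.cons.injEq] at hX
        have : sep ∈ cfgWord l q a r := by rw [← hl, ← hX.1]; simp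
        exact absurd this (sep_notMem_cfgWord l q a r)
    subst hA
    simp only [List.cons_append, List.nil_append, List.cons.injEq, true_and] at hX
    subst hX
    rw [List.append_nil] at hl
    refine ⟨Y ++ [sym default], [sym default], _, by simp,
      ⟨default :: l, q, a, r ++ [default], ?_, rfl⟩, by rwa [mkCfg_pad]⟩
    simp [hl, cfgWord]
  | copy x =>
    obtain ⟨A', B', e, hd'⟩ := describes_copy x hX hd
    exact ⟨A', B', c, e, hd', hc⟩
  | write q a q' b h =>
    refine key (by simp) hX fun P Q ⟨l, q₁, a₁, r, e, hc'⟩ => ?_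
    obtain ⟨rfl, rfl, rfl, rfl⟩ := cfgWord_split (P := P) (Q := Q) (by simpa using e)
    exact ⟨_, ⟨l, q', b, r, by simp [cfgWord], rfl⟩, by rw [hc']; exact step_mkCfg_write h l r⟩
  | right q a q' x h =>
    refine key (by simp) hX fun P Q ⟨l, q₁, a₁, r, e, hc'⟩ => ?_
    obtain ⟨rfl, rfl, rfl, e'⟩ := cfgWord_split (P := P) (Q := sym x :: Q) (by simpa using e)
    cases r with
    | nil => simp at e'
    | cons y r =>
      simp only [List.map_cons, List.cons.injEq, sym.injEq] at e'
      obtain ⟨rfl, rfl⟩ := e'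
      exact ⟨_, ⟨l ++ [a], q', x, r, by simp [cfgWord], rfl⟩,
        by rw [hc']; exact step_mkCfg_right h l x r⟩
  | left q a q' x h =>
    refine key (by simp) hX fun P Q ⟨l, q₁, a₁, r, e, hc'⟩ => ?_
    obtain ⟨e', rfl, rfl, rfl⟩ := cfgWord_split (P := P ++ [sym x]) (Q := Q) (by simpa using e)
    obtain ⟨l₁, l₂, rfl, rfl, h₂⟩ := List.append_eq_map_iff.1 e'
    obtain ⟨y, rfl, hy⟩ := List.map_eq_singleton_iff.1 h₂
    obtain rfl := sym.inj hy
    exact ⟨_, ⟨l₁, q', y, a :: r, by simp [cfgWord], rfl⟩,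
      by rw [hc']; exact step_mkCfg_left h l₁ y r⟩

theorem Circular.halts {c₀ : TM0.Cfg Γ Λ} {q : Λ} {a : Γ} {Y : List (Letter Γ Λ)}
    (h : Circular M c₀ (head q a :: Y)) (hM : M q a = none) :
    ∃ c, TM0.Reaches M c₀ c ∧ TM0.step M c = none := by
  obtain ⟨A, B, c, hX, ⟨l, q', a', r, e, rfl⟩, hc⟩ := h
  obtain ⟨A', rfl, -⟩ := exists_of_prefix (u := [head q a]) (by simp) hX
  obtain ⟨-, rfl, rfl, -⟩ := cfgWord_split (P := B) (Q := A') (by simpa using e)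
  exact ⟨_, hc, step_mkCfg_none hM l r⟩

/-- The meaning of the states during a run. -/
theorem invariant_of_run [Fintype Γ] [Fintype Λ] {c₀ : TM0.Cfg Γ Λ} {w W : List (Letter Γ Λ)}
    (hw : Circular M c₀ w) {s : ℕ} {U V : List (Letter Γ Λ)}
    (h : Run (startRule w :: machineRules M) s U V) (hU : U <+: W) (hV : V <+: W) :
    (s = 0 → U = [] ∧ V = []) ∧ (s = 1 → ∃ X, V = U ++ X ∧ Circular M c₀ X) ∧
      (s = 2 → ∃ c, TM0.Reaches M c₀ c ∧ TM0.step M c = none) := by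
  induction h with
  | nil => simp
  | @step s s' u v U V _ hr ih =>
    obtain ⟨h0, h1, h2⟩ := ih ((List.prefix_append _ _).trans hU) ((List.prefix_append _ _).trans hV)
    rcases List.mem_cons.1 hr with hr | hr
    · simp only [startRule, Prod.mk.injEq] at hr
      obtain ⟨rfl, rfl, rfl, rfl⟩ := hr
      obtain ⟨rfl, rfl⟩ := h0 rfl
      exact ⟨by simp, fun _ => ⟨v, rfl, hw⟩, by simp⟩
    · rcases mem_machineRules hr with ⟨rfl, hwk⟩ | ⟨rfl, rfl⟩
      · obtain ⟨X, rfl, hX⟩ := h1 rfl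
        have hlen : u.length ≤ 2 := by cases hwk <;> simp
        -- After `U`, both `u` and `X` are prefixes of the rest of `W`, and `u` is not longer.
        have huX : u <+: X := by
          obtain ⟨W', rfl⟩ := (List.prefix_append _ _).trans hU
          rw [List.prefix_append_right_inj] at hU
          rw [List.append_assoc, List.prefix_append_right_inj] at hV
          exact List.prefix_of_prefix_length_le hU ((List.prefix_append _ _).trans hV)
            (hlen.trans hX.two_le_length)
        obtain ⟨Y, rfl⟩ := huX
        by_cases hs : s' = 1
        · subst hs
          exact ⟨by simp, fun _ => ⟨Y ++ v, by simp, hX.work hwk⟩, by simp⟩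
        · cases hwk with
          | halt q a hM => exact ⟨by simp, by simp, fun _ => hX.halts hM⟩
          | _ => exact absurd rfl hs
      · exact ⟨by simp, by simp, fun _ => h2 rfl⟩

end Soundness

/-- The word that describes the initial configuration. -/
def initWord (a : Γ) (r : List Γ) : List (Letter Γ Λ) := cfgWord [] default a r ++ [sep]

theorem exists_run_iff_halts [Fintype Γ] [Fintype Λ] (M : TM0.Machine Γ Λ) (a : Γ) (r : List Γ) :
    (∃ U, Run (startRule (initWord a r) :: machineRules M) 2 U U) ↔ (TM0.eval M (a :: r)).Dom := by
  have hinit : (TM0.init (a :: r) : TM0.Cfg Γ Λ) = mkCfg [] default a r := rfl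
  have hdom : (TM0.eval M (a :: r)).Dom ↔
      ∃ c, TM0.Reaches M (mkCfg [] default a r) c ∧ TM0.step M c = none := by
    rw [← hinit]
    show (StateTransition.eval (TM0.step M) (TM0.init (a :: r))).Dom ↔ _
    rw [Part.dom_iff_mem]
    exact exists_congr fun c => StateTransition.mem_eval
  rw [hdom]
  constructor
  · rintro ⟨U, h⟩
    refine (invariant_of_run (W := U) ?_ h (List.prefix_refl _) (List.prefix_refl _)).2.2 rfl
    exact ⟨cfgWord [] default a r, [], _, rfl, ⟨[], default, a, r, rfl, rfl⟩, .refl⟩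
  · rintro ⟨c, hc, hs⟩
    have hR : machineRules M ⊆ startRule (initWord a r) :: machineRules M :=
      fun _ h => List.mem_cons_of_mem _ h
    have h0 : PendingCfg (startRule (initWord a r) :: machineRules M)
        (mkCfg [] default a r : TM0.Cfg Γ Λ) :=
      ⟨[], default, a, r, rfl, [], Run.nil.step List.mem_cons_self⟩
    exact (h0.reaches hR hc).exists_run hR hs

end TM0

end SemAc

/-! ### A fixed machine with undecidable halting, and the reduction -/

namespace SemAc

open Turing

/-! ### Restriction of a machine to a finite set of states -/

section Restrict

variable {Γ Λ : Type} [Inhabited Γ] [Inhabited Λ]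

/-- The restriction of a machine to a set of states that supports it. -/
noncomputable def restrictMachine (M : TM0.Machine Γ Λ) (S : Set Λ) [Inhabited S] :
    TM0.Machine Γ S := fun q a =>
  open Classical in
  (M q.1 a).bind fun p => if h : p.1 ∈ S then some (⟨p.1, h⟩, p.2) else none

theorem restrictMachine_none {M : TM0.Machine Γ Λ} {S : Set Λ} [Inhabited S] {q : S} {a : Γ}
    (h : M q.1 a = none) : restrictMachine M S q a = none := by
  simp [restrictMachine, h]

theorem restrictMachine_some {M : TM0.Machine Γ Λ} {S : Set Λ} [Inhabited S] {q : S} {a : Γ}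
    {p : Λ × TM0.Stmt Γ} (h : M q.1 a = some p) (hp : p.1 ∈ S) :
    restrictMachine M S q a = some (⟨p.1, hp⟩, p.2) := by
  simp [restrictMachine, h, hp]

/-- The effect of a statement on the tape. -/
def tapeAction (s : TM0.Stmt Γ) (T : Tape Γ) : Tape Γ :=
  match s with
  | TM0.Stmt.move d => T.move d
  | TM0.Stmt.write a => T.write a

/-- Since transitions from `S` stay in `S`, forgetting membership commutes with each step and
preserves halting. -/
theorem eval_restrictMachine_dom (M : TM0.Machine Γ Λ) {S : Set Λ} (hS : TM0.Supports M S)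
    [Inhabited S] (hdef : ((default : S) : Λ) = default) (l : List Γ) :
    (TM0.eval (restrictMachine M S) l).Dom ↔ (TM0.eval M l).Dom := by
  have hresp : StateTransition.Respects (TM0.step (restrictMachine M S)) (TM0.step M)
      fun (c : TM0.Cfg Γ S) (c' : TM0.Cfg Γ Λ) => (⟨c.q.1, c.Tape⟩ : TM0.Cfg Γ Λ) = c' := by
    rw [StateTransition.fun_respects]
    rintro ⟨q, T⟩
    rcases hM : M q.1 T.1 with _ | p
    · have e₁ : TM0.step (restrictMachine M S) ⟨q, T⟩ = none := by
        show Option.map _ (restrictMachine M S q T.1) = none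
        rw [restrictMachine_none hM]
        rfl
      have e₂ : TM0.step M ⟨q.1, T⟩ = none := by
        show Option.map _ (M q.1 T.1) = none
        rw [hM]
        rfl
      rw [e₁]
      exact e₂
    · have hp : p.1 ∈ S := hS.2 (show (p.1, p.2) ∈ M q.1 T.1 from hM) q.2
      have e₁ : TM0.step (restrictMachine M S) ⟨q, T⟩ = some ⟨⟨p.1, hp⟩, tapeAction p.2 T⟩ := by
        show Option.map _ (restrictMachine M S q T.1) = _
        rw [restrictMachine_some hM hp]
        rfl
      have e₂ : TM0.step M ⟨q.1, T⟩ = some ⟨p.1, tapeAction p.2 T⟩ := by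
        show Option.map _ (M q.1 T.1) = _
        rw [hM]
        rfl
      rw [e₁]
      exact Relation.TransGen.single e₂
  have hinit : (⟨((TM0.init l : TM0.Cfg Γ S).q).1, (TM0.init l : TM0.Cfg Γ S).Tape⟩ :
      TM0.Cfg Γ Λ) = TM0.init l := by
    simp only [TM0.init, hdef]
  exact (StateTransition.tr_eval_dom hresp hinit).symm

end Restrict

/-! ### A machine with an undecidable halting problem -/

/-- Inputs are passed as powers of two because their binary encoding is a constant symbol repeated,
which keeps the start rule easy to compute. -/
theorem trNat_two_pow (n : ℕ) :
    PartrecToTM2.trNat (2 ^ n) =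
      List.replicate n PartrecToTM2.Γ'.bit0 ++ [PartrecToTM2.Γ'.bit1] := by
  have h : ∀ n : ℕ, ∃ p : PosNum, ((2 ^ n : ℕ) : Num) = Num.pos p ∧ PartrecToTM2.trPosNum p =
      List.replicate n PartrecToTM2.Γ'.bit0 ++ [PartrecToTM2.Γ'.bit1] := by
    intro n
    induction n with
    | zero => exact ⟨1, by simp; rfl, rfl⟩
    | succ n ih =>
      obtain ⟨p, hp, hl⟩ := ih
      refine ⟨p.bit0, ?_, ?_⟩
      · rw [pow_succ, mul_two, Nat.cast_add, hp, Num.bit0_of_bit0]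
        rfl
      · rw [PartrecToTM2.trPosNum, hl]; rfl
  obtain ⟨p, hp, hl⟩ := h n
  rw [PartrecToTM2.trNat, hp]
  exact hl

/-- The exponent of a power of two. -/
def powTwoExponent (x : ℕ) : ℕ := Nat.findGreatest (fun n => 2 ^ n = x) x

theorem powTwoExponent_two_pow (n : ℕ) : powTwoExponent (2 ^ n) = n := by
  have h : 2 ^ powTwoExponent (2 ^ n) = 2 ^ n :=
    Nat.findGreatest_spec (P := fun k => 2 ^ k = 2 ^ n) Nat.lt_two_pow_self.le rfl
  exact Nat.pow_right_injective le_rfl h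

theorem primrec_powTwoExponent : Primrec powTwoExponent := by
  have hpow : Primrec fun n : ℕ => 2 ^ n := by
    have : Primrec (Nat.rec 1 fun _ x => 2 * x : ℕ → ℕ) :=
      Primrec.nat_rec₁ 1 (Primrec.nat_mul.comp (Primrec.const 2) Primrec.snd)
    refine this.of_eq fun n => ?_
    induction n with
    | zero => rfl
    | succ n ih => rw [pow_succ, ← ih, mul_comm]
  exact Primrec.nat_findGreatest Primrec.id
    (PrimrecRel.comp Primrec.eq (hpow.comp Primrec.snd) Primrec.fst)

theorem exists_code_halting : ∃ c : ToPartrec.Code, ∀ n : ℕ, (c.eval [2 ^ n]).Dom ↔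
    ((Denumerable.ofNat Nat.Partrec.Code n).eval 0).Dom := by
  have hF : Partrec fun x : ℕ => (Denumerable.ofNat Nat.Partrec.Code (powTwoExponent x)).eval 0 :=
    Nat.Partrec.Code.eval_part.comp
      ((Computable.ofNat _).comp primrec_powTwoExponent.to_comp) (Computable.const 0)
  obtain ⟨c, hc⟩ := ToPartrec.Code.exists_code (Nat.Partrec'.part_iff₁.2 hF)
  refine ⟨c, fun n => ?_⟩
  have := hc ⟨[2 ^ n], rfl⟩
  rw [show (⟨[2 ^ n], rfl⟩ : List.Vector ℕ 1).1 = [2 ^ n] from rfl] at this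
  rw [this]
  show ((Denumerable.ofNat Nat.Partrec.Code (powTwoExponent (2 ^ n))).eval 0).Dom ↔ _
  rw [powTwoExponent_two_pow]

/-- A machine with finitely many symbols and states whose halting problem, on inputs of a simple
form, is that of partial recursive functions. -/
theorem exists_machine_halting : ∃ (Γ Λ : Type) (_ : Inhabited Γ) (_ : Inhabited Λ)
    (_ : Fintype Γ) (_ : Fintype Λ) (M : TM0.Machine Γ Λ) (a b c : Γ), ∀ n : ℕ,
      (TM0.eval M (a :: b :: List.replicate n c)).Dom ↔
        ((Denumerable.ofNat Nat.Partrec.Code n).eval 0).Dom := by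
  obtain ⟨code, hcode⟩ := exists_code_halting
  let iΛ : Inhabited PartrecToTM2.Λ' := ⟨PartrecToTM2.trNormal code PartrecToTM2.Cont'.halt⟩
  let M₂ := PartrecToTM2.tr
  have s₂ : TM2.Supports M₂ (PartrecToTM2.codeSupp code PartrecToTM2.Cont'.halt) :=
    PartrecToTM2.tr_supports code PartrecToTM2.Cont'.halt
  let M₁ := TM2to1.tr M₂
  have s₁ := TM2to1.tr_supports M₂ s₂
  let M₀ := TM1to0.tr M₁
  have s₀ := TM1to0.tr_supports M₁ s₁
  let S : Set (TM1to0.Λ' M₁) := ↑(TM1to0.trStmts M₁ (TM2to1.trSupp M₂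
    (PartrecToTM2.codeSupp code PartrecToTM2.Cont'.halt)))
  let iS : Inhabited S := ⟨⟨default, s₀.1⟩⟩
  -- A tape cell holds one entry of each stack, here only of the main one; the Boolean marks the
  -- bottom of the stacks.
  let f : PartrecToTM2.Γ' → TM2to1.Γ' PartrecToTM2.K' (fun _ => PartrecToTM2.Γ') := fun x =>
    (false, Function.update (fun _ => none) PartrecToTM2.K'.main (some x))
  let bottom : TM2to1.Γ' PartrecToTM2.K' (fun _ => PartrecToTM2.Γ') :=
    (true, (f PartrecToTM2.Γ'.cons).2)
  have hinit : ∀ n, TM2to1.trInit (Γ := fun _ => PartrecToTM2.Γ') PartrecToTM2.K'.main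
      (PartrecToTM2.trList [2 ^ n]) =
        bottom :: f PartrecToTM2.Γ'.bit1 :: List.replicate n (f PartrecToTM2.Γ'.bit0) := by
    intro n
    have e : (PartrecToTM2.trList [2 ^ n]).reverse = PartrecToTM2.Γ'.cons ::
        PartrecToTM2.Γ'.bit1 :: List.replicate n PartrecToTM2.Γ'.bit0 := by
      simp [PartrecToTM2.trList, trNat_two_pow]
    rw [TM2to1.trInit, e, ← List.map_replicate]
    rfl
  let iK : Fintype PartrecToTM2.K' :=
    ⟨{.main, .rev, .aux, .stack}, by rintro ⟨⟩ <;> simp⟩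
  refine ⟨TM2to1.Γ' PartrecToTM2.K' (fun _ => PartrecToTM2.Γ'), S, inferInstance, iS,
    inferInstance, Finset.fintypeCoeSort _, restrictMachine M₀ S,
    bottom, f PartrecToTM2.Γ'.bit1, f PartrecToTM2.Γ'.bit0, fun n => ?_⟩
  rw [eval_restrictMachine_dom M₀ s₀ rfl, ← hinit, TM1to0.tr_eval]
  refine (TM2to1.tr_eval_dom PartrecToTM2.tr PartrecToTM2.K'.main _).trans (Iff.trans ?_ (hcode n))
  have h2 : (TM2.init PartrecToTM2.K'.main (PartrecToTM2.trList [2 ^ n]) : PartrecToTM2.Cfg') =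
      PartrecToTM2.init code [2 ^ n] := by
    unfold TM2.init PartrecToTM2.init
    congr 1
    funext k
    cases k <;> rfl
  have h3 := PartrecToTM2.tr_eval code [2 ^ n]
  show (StateTransition.eval (TM2.step M₂)
    (TM2.init PartrecToTM2.K'.main (PartrecToTM2.trList [2 ^ n]))).Dom ↔ _
  rw [h2, h3]
  rfl

/-! ### Runs over an alphabet of natural numbers -/

/-- The image of a rule under a map of letters. -/
def Rule.map {α β : Type} (f : α → β) (ρ : Rule α) : Rule β :=
  (ρ.1, ρ.2.1.map f, ρ.2.2.1.map f, ρ.2.2.2)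

theorem Run.map {α β : Type} (f : α → β) {R : List (Rule α)} {s : ℕ} {U V : List α}
    (h : Run R s U V) : Run (R.map (Rule.map f)) s (U.map f) (V.map f) := by
  induction h with
  | nil => exact .nil
  | step _ hr ih =>
    rw [List.map_append, List.map_append]
    exact ih.step (List.mem_map.2 ⟨_, hr, rfl⟩)

theorem Run.exists_of_map {α β : Type} {f : α → β} {R : List (Rule α)} {s : ℕ} {U V : List β}
    (h : Run (R.map (Rule.map f)) s U V) : ∃ U' V', U = U'.map f ∧ V = V'.map f ∧ Run R s U' V' := by
  induction h with
  | nil => exact ⟨[], [], rfl, rfl, .nil⟩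
  | step _ hr ih =>
    obtain ⟨U', V', rfl, rfl, h⟩ := ih
    obtain ⟨⟨s, u, v, s'⟩, hmem, e⟩ := List.mem_map.1 hr
    simp only [Rule.map, Prod.mk.injEq] at e
    obtain ⟨rfl, rfl, rfl, rfl⟩ := e
    exact ⟨_, _, (List.map_append).symm, (List.map_append).symm, h.step hmem⟩

/-- Injectivity is what lets equality of the two coded words pass back to the original words. -/
theorem exists_run_map_iff {α β : Type} {f : α → β} (hf : Function.Injective f)
    {R : List (Rule α)} {s : ℕ} :
    (∃ U, Run (R.map (Rule.map f)) s U U) ↔ ∃ U, Run R s U U := by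
  constructor
  · rintro ⟨U, h⟩
    obtain ⟨U', V', e, e', h⟩ := h.exists_of_map
    obtain rfl := List.map_injective_iff.2 hf (e.symm.trans e')
    exact ⟨U', h⟩
  · rintro ⟨U, h⟩
    exact ⟨_, h.map f⟩

theorem exists_letterCode (Γ Λ : Type) [Fintype Γ] [Fintype Λ] :
    ∃ (m : ℕ) (f : Letter Γ Λ → ℕ), 0 < m ∧ Function.Injective f ∧ ∀ c, f c < m := by
  classical
  refine ⟨(allLetters Γ Λ).length, fun c => termIdx (allLetters Γ Λ) c, by simp [allLetters],
    fun c d h => ?_, fun c => termIdx_lt (mem_allLetters c)⟩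
  have hc := getElem_termIdx (termIdx_lt (mem_allLetters c))
  have hd := getElem_termIdx (termIdx_lt (mem_allLetters d))
  rw [← hc, ← hd]
  congr 1

theorem rulesBounded_map {Γ Λ : Type} [Inhabited Γ] [Inhabited Λ] [Fintype Γ] [Fintype Λ]
    (M : TM0.Machine Γ Λ) (w : List (Letter Γ Λ)) {m : ℕ} {f : Letter Γ Λ → ℕ}
    (hf : ∀ c, f c < m) :
    RulesBounded m ((startRule w :: machineRules M).map (Rule.map f)) := by
  intro s u v s' h
  obtain ⟨⟨t, x, y, t'⟩, hmem, e⟩ := List.mem_map.1 h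
  simp only [Rule.map, Prod.mk.injEq] at e
  obtain ⟨rfl, rfl, rfl, rfl⟩ := e
  have hs : t < 3 ∧ t' < 3 := by
    rcases List.mem_cons.1 hmem with h | h
    · simp only [startRule, Prod.mk.injEq] at h
      omega
    · rcases mem_machineRules h with ⟨rfl, hw⟩ | ⟨rfl, rfl⟩
      · cases hw <;> omega
      · omega
  refine ⟨hs.1, hs.2, ?_, ?_⟩ <;>
  · simp only [List.mem_map]
    rintro i ⟨c, -, rfl⟩
    exact hf c

/-! ### The reduction -/

theorem primrec_replicate {α : Type} [Primcodable α] (a : α) :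
    Primrec fun n : ℕ => List.replicate n a := by
  have h : Primrec fun n : ℕ => (List.range n).map fun _ => a :=
    Primrec.list_map Primrec.list_range (Primrec.const a).to₂
  exact h.of_eq fun n => by simp

theorem primrec_bin : Primrec fun p : ℕ × ℕ × ℕ => bin p.1 p.2.1 p.2.2 :=
  Primrec.pair Primrec.fst
    (Primrec.list_cons.comp (Primrec.sumInr.comp (Primrec.fst.comp Primrec.snd))
      (Primrec.list_cons.comp (Primrec.sumInr.comp (Primrec.snd.comp Primrec.snd))
        (Primrec.const [])))

theorem primrec_pathAtoms (k : ℕ) : Primrec (pathAtoms k) := by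
  refine Primrec.list_map (Primrec.list_range.comp Primrec.list_length) ?_
  have hi : Primrec fun p : List ℕ × ℕ => k + p.2 :=
    Primrec.nat_add.comp (Primrec.const k) Primrec.snd
  exact primrec_bin.comp (Primrec.pair ((Primrec.list_getD 0).comp Primrec.fst Primrec.snd)
    (Primrec.pair hi (Primrec.succ.comp hi)))

theorem primrec_wordY : Primrec wordY := by
  refine Primrec.list_flatMap Primrec.id ?_
  exact Primrec.list_cons.comp (Primrec.const 1) (Primrec.list_cons.comp (Primrec.const 2)
    (Primrec.list_cons.comp (Primrec.nat_add.comp (Primrec.const 6) Primrec.snd)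
      (Primrec.const [0])))

theorem primrec_ruleTGD_startRule : Primrec fun w : List ℕ => ruleTGD (startRule w) := by
  have hl : Primrec fun w : List ℕ => 1 + 4 * w.length :=
    Primrec.nat_add.comp (Primrec.const 1)
      (Primrec.nat_mul.comp (Primrec.const 4) Primrec.list_length)
  have h : Primrec fun w : List ℕ =>
      ((bin 3 0 1 :: pathAtoms 1 (wordY w), [bin 4 0 (1 + 4 * w.length)]) : TGD) :=
    Primrec.pair
      (Primrec.list_cons.comp (Primrec.const _) ((primrec_pathAtoms 1).comp primrec_wordY))
      (Primrec.list_cons.comp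
        (primrec_bin.comp (Primrec.pair (Primrec.const 4) (Primrec.pair (Primrec.const 0) hl)))
        (Primrec.const []))
  exact h.of_eq fun w => rfl

/-- The machine, and with it the schema, the query and all tgds but one, is fixed. The tgd of the
start rule is primitive recursive in `n`, so a decision procedure would decide halting of the `n`-th
code on input 0. -/
theorem semAcProblem_not_isDecidable : ¬ (SemAcProblem FullTGDs).IsDecidable := by
  rintro ⟨dec, hdec, hspec⟩
  obtain ⟨Γ, Λ, iΓ, iΛ, fΓ, fΛ, M, a, b, c, hM⟩ := exists_machine_halting
  obtain ⟨m, f, hm, hf, hfm⟩ := exists_letterCode Γ Λ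
  let w : ℕ → List (Letter Γ Λ) := fun n => initWord a (b :: List.replicate n c)
  let R : ℕ → List (Rule ℕ) := fun n => (startRule (w n) :: machineRules M).map (Rule.map f)
  let input : ℕ → Schema × CQ × List TGD := fun n => (wordSchema m, cycleQuery m, ruleTGDs m (R n))
  have hw : Primrec fun n => (w n).map f := by
    have h : Primrec fun n : ℕ => f (.head default a) :: f (.sym b) ::
        (List.replicate n (f (.sym c)) ++ [f .sep]) :=
      Primrec.list_cons.comp (Primrec.const _) (Primrec.list_cons.comp (Primrec.const _)
        (Primrec.list_append.comp (primrec_replicate _) (Primrec.const _)))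
    exact h.of_eq fun n => by simp [w, initWord, cfgWord]
  have hinput : Primrec input := by
    refine Primrec.pair (Primrec.const _) (Primrec.pair (Primrec.const _) ?_)
    have h : Primrec fun n => initTGD :: goalTGD m :: ruleTGD (startRule ((w n).map f)) ::
        ((machineRules M).map (Rule.map f)).map ruleTGD :=
      Primrec.list_cons.comp (Primrec.const _) (Primrec.list_cons.comp (Primrec.const _)
        (Primrec.list_cons.comp (primrec_ruleTGD_startRule.comp hw) (Primrec.const _)))
    exact h.of_eq fun n => rfl
  have hR : ∀ n, RulesBounded m (R n) := fun n => rulesBounded_map M (w n) hfm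
  have hiff : ∀ n, dec (input n) = true ↔
      ((Denumerable.ofNat Nat.Partrec.Code n).eval 0).Dom := fun n => by
    rw [hspec (input n) ⟨cycleQuery_isOver m, ruleTGDs_isOver (hR n), ruleTGDs_full m (R n)⟩]
    show SemanticallyAcyclic (wordSchema m) (ruleTGDs m (R n)) (cycleQuery m) ↔ _
    rw [semanticallyAcyclic_iff_run hm (hR n), exists_run_map_iff hf, exists_run_iff_halts, hM]
  classical
  refine ComputablePred.halting_problem 0 ⟨inferInstance, ?_⟩
  have hcomp : Computable fun e : Nat.Partrec.Code => dec (input (Encodable.encode e)) :=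
    hdec.comp (hinput.to_comp.comp Computable.encode)
  refine hcomp.of_eq fun e => ?_
  have := hiff (Encodable.encode e)
  rw [Denumerable.ofNat_encode] at this
  exact Bool.eq_iff_iff.2 (this.trans decide_eq_true_iff.symm)

end SemAc

theorem theorem3 :
    (SemAc.ContProblem SemAc.FullTGDs).IsDecidable ∧
      ¬ (SemAc.SemAcProblem SemAc.FullTGDs).IsDecidable :=
  ⟨SemAc.contProblem_isDecidable, SemAc.semAcProblem_not_isDecidable⟩
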